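/- **Setting.** Let $X,U$ be complex Banach spaces, $\mathfrak A:D(\mathfrak A)\subset X\to X$ a closed operator, and let $\mathfrak B:D(\mathfrak A)\to U$ be linear and closed, where $D(\mathfrak A)$ carries the graph norm. Assume that $A:=\mathfrak A|_{\ker\mathfrak B}$ generates a $C_0$-semigroup $(T(t))_{t\ge0}$ on $X$ and that $\mathfrak B$ has a right-inverse $B_0\in\mathcal L(U,D(\mathfrak A))$ (i.e. $(\mathfrak A,\mathfrak B)$ is a boundary control system). For $\lambda$ in the resolvent set of $A$ let $X_{-1}$ be the completion of $X$ with respect to $\|(\lambda-A)^{-1}\cdot\|$, let $T_{-1}(t)\in\mathcal L(X_{-1})$ and $A_{-1}\in\mathcal L(X,X_{-1})$ be the unique bounded extensions of $T(t)$ and $A$, and put $B:=\mathfrak A B_0-A_{-1}B_0\in\mathcal L(U,X_{-1})$. Let $\mathcal Z$ be $L^q$ with $1\le q<\infty$, or $C$ (continuous functions), or $\mathrm{Reg}$ (regulated functions, i.e. uniform limits of step functions). $\|\cdot\|_{\mathcal Z([0,t];U)}$ is the $L^q$-norm, respectively the (essential) supremum norm, and $\mathcal Z_{\rm loc}(\mathbb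 R_+;U)$ is the set of $u:[0,\infty)\to U$ with $u|_{[0,\tau]}\in\mathcal Z([0,\tau];U)$ for all $\tau>0$. $\mathcal K$ is the class of continuous, strictly increasing $\mu:[0,\infty)\to[0,\infty)$ with $\mu(0)=0$, and $\mathcal{KL}$ the class of $\beta:[0,\infty)^2\to[0,\infty)$ such that $\beta(\cdot,t)\in\mathcal K$ for every $t\ge0$ and, for every $s>0$, $\beta(s,\cdot)$ is continuous, strictly decreasing and tends to $0$ at infinity. A system with a given notion of solution is called $\mathcal Z$-ISS if for all $x_0\in X$ and $u\in\mathcal Z_{\rm loc}(\mathbb R_+;U)$ it has a unique solution $x:[0,\infty)\to X$, and there are $\beta\in\mathcal{KL}$, $\gamma\in\mathcal K$ such that $\|x(t)\|\le\beta(\|x_0\|,t)+\gamma(\|u\|_{\mathcal Z([0,t];U)})$ for all $t>0$ and all such $x_0,u$. For the linear system a solution is a function $x:[0,\infty)\to X$ with $$x(t)=T(t)x_0+\int_0^tT_{-1}(t-s)Bu(s)\,ds\quad\text{in }X_{-1},\ t\ge0$$ (continuity of $x$ is not required). For $f:[0,\infty)\times X\to X$, a mild solution on $[0,\tau]$ of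 the semilinear system $\dot x=\mathfrak Ax+f(t,x)$, $\mathfrak Bx=u$, $x(0)=x_0$ is an $x\in C([0,\tau];X)$ with $$x(t)=T(t)x_0+\int_0^tT_{-1}(t-s)\,[f(s,x(s))+Bu(s)]\,ds\quad\text{in }X_{-1},\ t\in[0,\tau];$$ a global mild solution is an $x:[0,\infty)\to X$ that is a mild solution on $[0,\tau]$ for every $\tau>0$. **Theorem.** Let the linear system $(\mathfrak A,\mathfrak B)$ be $\mathcal Z$-ISS, and let $M\ge1$, $\omega<0$ be such that $\|T(t)\|\le Me^{\omega t}$ for all $t>0$. Let $f:[0,\infty)\times X\to X$ be continuous in the first variable, with $\|f(t,x)-f(t,y)\|\le L_f\|x-y\|$ for all $t\ge0$, $x,y\in X$, where $L_f>0$, and $f(t,0)=0$ for all $t\ge0$. If $\omega+ML_f<0$, then: 1. For all $x_0\in X$, $u\in\mathcal Z_{\rm loc}(\mathbb R_+;U)$ the semilinear system has a unique global mild solution $x\in C([0,\infty);X)$, and the semilinear system is $\mathcal Z$-ISS. 2. More precisely, there are $\beta\in\mathcal{KL}$ and a constant $\sigma>0$ such that for all $t>0$, $x_0\in X$ and $u\in\mathcal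 Z([0,t];U)$ a mild solution on $[0,t]$ exists, and every mild solution $x$ on $[0,t]$ satisfies $$\|x(t)\|\le\beta(\|x_0\|,t)+\sigma\|u\|_{\mathcal Z([0,t];U)}\quad\text{and}\quad\|x(t)\|\le\beta(\|x_0\|,t)+\sigma\,\|u\|_{L^\infty(0,t;U)}$$ (the second estimate being void if $u$ is not essentially bounded on $[0,t]$). -/

import Mathlib

open Set Filter Topology MeasureTheory
open scoped ENNReal

noncomputable section

/-! ### Comparison functions -/

/-- Class `𝒦`: continuous, strictly increasing functions on `[0,∞)` vanishing at `0`. -/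
def IsClassK (μ : ℝ → ℝ) : Prop :=
  μ 0 = 0 ∧ ContinuousOn μ (Ici 0) ∧ StrictMonoOn μ (Ici 0)

/-- Class `ℒ`: nonnegative, continuous, strictly decreasing functions on `[0,∞)` with limit `0`
at `∞`. -/
def IsClassL (θ : ℝ → ℝ) : Prop :=
  (∀ t, 0 ≤ t → 0 ≤ θ t) ∧ ContinuousOn θ (Ici 0) ∧ StrictAntiOn θ (Ici 0) ∧
    Tendsto θ atTop (𝓝 0)

/-- Class `𝒦ℒ`: `β(·,t) ∈ 𝒦` for every `t ≥ 0` and `β(s,·) ∈ ℒ` for every `s > 0`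
(for `s = 0` the function `β(0,·)` is identically zero). -/
def IsClassKL (β : ℝ → ℝ → ℝ) : Prop :=
  (∀ t, 0 ≤ t → IsClassK (fun s => β s t)) ∧ (∀ s, 0 < s → IsClassL (β s))

/-! ### Classes of input functions -/

/-- The classes `L^q` with `1 ≤ q < ∞`, `C` and `Reg`. -/
inductive InputClass : Type
  | Lq (q : ℝ≥0∞) (one_le : 1 ≤ q) (ne_top : q ≠ ∞)
  | C
  | Reg

section Inputs

variable {U : Type*} [NormedAddCommGroup U]

/-- `g` is a step function on `[0,τ]`: constant on the open intervals of a finite partition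
`0 = a 0 ≤ a 1 ≤ ⋯ ≤ a n = τ`. -/
def IsStepOn (τ : ℝ) (g : ℝ → U) : Prop :=
  ∃ (n : ℕ) (a : ℕ → ℝ), Monotone a ∧ a 0 = 0 ∧ a n = τ ∧
    ∀ i, i < n → ∃ c : U, ∀ s ∈ Ioo (a i) (a (i + 1)), g s = c

/-- `u` is regulated on `[0,τ]`: a uniform limit of step functions. -/
def IsRegulatedOn (τ : ℝ) (u : ℝ → U) : Prop :=
  ∀ ε : ℝ, 0 < ε → ∃ g : ℝ → U, IsStepOn τ g ∧ ∀ s ∈ Icc 0 τ, ‖u s - g s‖ ≤ ε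

namespace InputClass

/-- `u|_{[0,τ]} ∈ 𝒵([0,τ];U)`. -/
def MemOn : InputClass → ℝ → (ℝ → U) → Prop
  | Lq q _ _, τ, u => MemLp u q (volume.restrict (Icc 0 τ))
  | C, τ, u => ContinuousOn u (Icc 0 τ)
  | Reg, τ, u => IsRegulatedOn τ u

/-- `u ∈ 𝒵_loc(ℝ₊;U)`. -/
def MemLoc (Z : InputClass) (u : ℝ → U) : Prop :=
  ∀ τ : ℝ, 0 < τ → Z.MemOn τ u

/-- `q` for `L^q` and `∞` for `C` and `Reg`. -/
def exponent : InputClass → ℝ≥0∞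
  | Lq q _ _ => q
  | C => ∞
  | Reg => ∞

/-- The norm of `u|_{[0,τ]}` in `𝒵([0,τ];U)`: the `L^q`-norm for `L^q`, the (essential) supremum
norm for `C` and `Reg`. -/
def normOn (Z : InputClass) (τ : ℝ) (u : ℝ → U) : ℝ :=
  (eLpNorm u Z.exponent (volume.restrict (Icc 0 τ))).toReal

end InputClass

end Inputs

/-! ### Semigroups and boundary control systems -/

section Semigroup

variable {X : Type*} [NormedAddCommGroup X] [NormedSpace ℂ X]

/-- Strongly continuous semigroups `(T(t))_{t ≥ 0}`; values at `t < 0` are irrelevant. -/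
structure IsC0Semigroup (T : ℝ → X →L[ℂ] X) : Prop where
  map_zero : T 0 = ContinuousLinearMap.id ℂ X
  map_add : ∀ s t, 0 ≤ s → 0 ≤ t → T (s + t) = (T s).comp (T t)
  continuousOn : ∀ x, ContinuousOn (fun t => T t x) (Ici 0)

/-- `A` is the infinitesimal generator of `T`, including its domain. -/
def IsGeneratorOf (A : X →ₗ.[ℂ] X) (T : ℝ → X →L[ℂ] X) : Prop :=
  ∀ x y : X, (x, y) ∈ A.graph ↔
    Tendsto (fun h : ℝ => h⁻¹ • (T h x - x)) (𝓝[>] 0) (𝓝 y)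

end Semigroup

/-- The restriction of an operator `A` to the kernel of `G : D(A) → U`. -/
def kerRestrict {X U : Type*} [NormedAddCommGroup X] [NormedSpace ℂ X]
    [NormedAddCommGroup U] [NormedSpace ℂ U]
    (A : X →ₗ.[ℂ] X) (G : A.domain →ₗ[ℂ] U) : X →ₗ.[ℂ] X :=
  A.domRestrict ((LinearMap.ker G).map A.domain.subtype)

/-- A linear boundary control system `(𝔄, 𝔅)`, together with the semigroup `T` generated by
`A = 𝔄|_{ker 𝔅}` (which is uniquely determined) and a right-inverse `B₀` of `𝔅`.
The domain `D(𝔄)` carries the graph norm. -/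
structure BoundaryControlSystem (X U : Type*) [NormedAddCommGroup X] [NormedSpace ℂ X]
    [NormedAddCommGroup U] [NormedSpace ℂ U] where
  /-- the operator `𝔄 : D(𝔄) ⊆ X → X` -/
  opA : X →ₗ.[ℂ] X
  /-- the boundary operator `𝔅 : D(𝔄) → U` -/
  opB : opA.domain →ₗ[ℂ] U
  closed_opA : opA.IsClosed
  /-- `𝔅` is closed as an operator from `D(𝔄)`, with the graph norm, to `U` -/
  closed_opB : IsClosed {p : X × X × U | ∃ x : opA.domain, p = ((x : X), opA x, opB x)}
  /-- the semigroup -/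
  T : ℝ → X →L[ℂ] X
  semigroup : IsC0Semigroup T
  generator : IsGeneratorOf (kerRestrict opA opB) T
  /-- the right-inverse `B₀` -/
  B0 : U →ₗ[ℂ] opA.domain
  B0_bounded : ∃ K : ℝ, ∀ v : U, ‖(B0 v : X)‖ + ‖opA (B0 v)‖ ≤ K * ‖v‖
  opB_B0 : ∀ v : U, opB (B0 v) = v

namespace BoundaryControlSystem

variable {X U : Type*} [NormedAddCommGroup X] [NormedSpace ℂ X]
  [NormedAddCommGroup U] [NormedSpace ℂ U]

/-- The generator `A = 𝔄|_{ker 𝔅}`. -/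
def A (S : BoundaryControlSystem X U) : X →ₗ.[ℂ] X := kerRestrict S.opA S.opB

/-- A point `lam` of the resolvent set of `A` and the bounded operator `R = (lam - A)⁻¹`. -/
structure ResolventPoint (S : BoundaryControlSystem X U) where
  /-- the point of the resolvent set -/
  lam : ℂ
  /-- the resolvent -/
  R : X →L[ℂ] X
  left_inv : ∀ x : S.A.domain, R (lam • (x : X) - S.A x) = x
  right_inv : ∀ y : X, ∃ x : S.A.domain, (x : X) = R y ∧ lam • (x : X) - S.A x = y

variable (S : BoundaryControlSystem X U) (ρ : S.ResolventPoint)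

theorem R_injective : Function.Injective ρ.R := by
  intro y z h
  obtain ⟨a, ha, ha'⟩ := ρ.right_inv y
  obtain ⟨b, hb, hb'⟩ := ρ.right_inv z
  have : a = b := Subtype.ext (by rw [ha, hb, h])
  rw [← ha', ← hb', this]

theorem R_comm (t : ℝ) (ht : 0 ≤ t) (y : X) : ρ.R (S.T t y) = S.T t (ρ.R y) := by
  obtain ⟨x, hx, hxy⟩ := ρ.right_inv y
  have hg := (S.generator (x : X) (S.A x)).1 (LinearPMap.mem_graph S.A x)
  have hg' : (S.T t (x : X), S.T t (S.A x)) ∈ S.A.graph := by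
    refine (S.generator _ _).2 ?_
    refine (((S.T t).continuous.tendsto _).comp hg).congr' ?_
    filter_upwards [self_mem_nhdsWithin] with h hh
    have hh0 : (0 : ℝ) ≤ h := le_of_lt hh
    have e : S.T t (S.T h (x : X)) = S.T h (S.T t (x : X)) := by
      rw [← ContinuousLinearMap.comp_apply, ← ContinuousLinearMap.comp_apply,
        ← S.semigroup.map_add t h ht hh0, ← S.semigroup.map_add h t hh0 ht, add_comm]
    have e' : h⁻¹ • (S.T h (x : X) - x) = ((h⁻¹ : ℝ) : ℂ) • (S.T h (x : X) - x) :=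
      (Complex.coe_smul _ _).symm
    simp only [Function.comp_apply]
    rw [e', map_smul, map_sub, e, Complex.coe_smul]
  obtain ⟨z, hz1, hz2⟩ := (LinearPMap.mem_graph_iff S.A).1 hg'
  simp only at hz1 hz2
  have h := ρ.left_inv z
  rw [hz1, hz2, ← map_smul, ← map_sub, hxy] at h
  rw [h, hx]

theorem exists_bound_B0 : ∃ K : ℝ, ∀ v : U,
    ‖(S.opA.domain.subtype ∘ₗ S.B0) v‖ ≤ K * ‖v‖ := by
  obtain ⟨K, hK⟩ := S.B0_bounded
  exact ⟨K, fun v => (le_add_of_nonneg_right (norm_nonneg _)).trans (hK v)⟩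

theorem exists_bound_AB0 : ∃ K : ℝ, ∀ v : U, ‖(S.opA.toFun ∘ₗ S.B0) v‖ ≤ K * ‖v‖ := by
  obtain ⟨K, hK⟩ := S.B0_bounded
  exact ⟨K, fun v => (le_add_of_nonneg_left (norm_nonneg _)).trans (hK v)⟩

/-- `B₀` as a bounded operator `U → X`. -/
def B0L : U →L[ℂ] X :=
  LinearMap.mkContinuousOfExistsBound (S.opA.domain.subtype ∘ₗ S.B0) S.exists_bound_B0

/-- `𝔄B₀` as a bounded operator `U → X`. -/
def AB0L : U →L[ℂ] X :=
  LinearMap.mkContinuousOfExistsBound (S.opA.toFun ∘ₗ S.B0) S.exists_bound_AB0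

/-! ### The extrapolation space `X₋₁` -/

/-- The vector space `X`, to be normed by `‖(lam - A)⁻¹ ·‖`. -/
def PreExtrapolation (_ρ : S.ResolventPoint) : Type _ := X

instance : AddCommGroup (S.PreExtrapolation ρ) := inferInstanceAs (AddCommGroup X)
instance : Module ℂ (S.PreExtrapolation ρ) := inferInstanceAs (Module ℂ X)

/-- The identity from `X` to `PreExtrapolation`. -/
def toPre : X →ₗ[ℂ] S.PreExtrapolation ρ := LinearMap.id (R := ℂ) (M := X)

/-- The resolvent as a linear map on `PreExtrapolation`. -/
def preR : S.PreExtrapolation ρ →ₗ[ℂ] X := (ρ.R : X →ₗ[ℂ] X)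

instance : NormedAddCommGroup (S.PreExtrapolation ρ) :=
  NormedAddCommGroup.induced (S.PreExtrapolation ρ) X (S.preR ρ) (S.R_injective ρ)

instance : NormedSpace ℂ (S.PreExtrapolation ρ) :=
  NormedSpace.induced ℂ (S.PreExtrapolation ρ) X (S.preR ρ)

/-- `X₋₁`: the completion of `X` with respect to the norm `‖(lam - A)⁻¹ ·‖`. -/
def Extrapolation : Type _ := UniformSpace.Completion (S.PreExtrapolation ρ)

instance : NormedAddCommGroup (S.Extrapolation ρ) :=
  inferInstanceAs (NormedAddCommGroup (UniformSpace.Completion (S.PreExtrapolation ρ)))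
instance : NormedSpace ℂ (S.Extrapolation ρ) :=
  inferInstanceAs (NormedSpace ℂ (UniformSpace.Completion (S.PreExtrapolation ρ)))
instance : CompleteSpace (S.Extrapolation ρ) :=
  inferInstanceAs (CompleteSpace (UniformSpace.Completion (S.PreExtrapolation ρ)))

/-- The canonical isometry of `(X, ‖(lam - A)⁻¹ ·‖)` into its completion. -/
def preι : S.PreExtrapolation ρ →ₗᵢ[ℂ] S.Extrapolation ρ :=
  UniformSpace.Completion.toComplₗᵢ (𝕜 := ℂ) (E := S.PreExtrapolation ρ)

theorem norm_toPre (x : X) : ‖S.toPre ρ x‖ = ‖ρ.R x‖ := rfl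

/-- The canonical embedding `X → X₋₁`. -/
def ι : X →L[ℂ] S.Extrapolation ρ :=
  LinearMap.mkContinuous ((S.preι ρ).toLinearMap ∘ₗ S.toPre ρ) ‖ρ.R‖ (fun x => by
    change ‖S.preι ρ (S.toPre ρ x)‖ ≤ _
    rw [LinearIsometry.norm_map, norm_toPre]
    exact ρ.R.le_opNorm x)

theorem norm_ι (x : X) : ‖S.ι ρ x‖ = ‖ρ.R x‖ := (S.preι ρ).norm_map _

theorem ι_injective : Function.Injective (S.ι ρ) := (S.preι ρ).injective

theorem denseRange_ι : DenseRange (S.ι ρ) :=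
  UniformSpace.Completion.denseRange_coe (α := S.PreExtrapolation ρ)

variable [CompleteSpace X]

theorem dense_domain : Dense (S.A.domain : Set X) := by
  intro x
  set g : ℝ → X := fun s => S.T (max s 0) x with hg
  have hgc : Continuous g :=
    (S.semigroup.continuousOn x).comp_continuous (by fun_prop) (fun s => mem_Ici.2 (le_max_right _ _))
  set F : ℝ → X := fun t => ∫ s in (0 : ℝ)..t, g s with hF
  have hFd : ∀ t, HasDerivAt F (g t) t := fun t =>
    intervalIntegral.integral_hasDerivAt_right (hgc.intervalIntegrable _ _)
      (hgc.stronglyMeasurableAtFilter _ _) hgc.continuousAt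
  have hg0 : g 0 = x := by simp [hg, S.semigroup.map_zero]
  have hF0 : F 0 = 0 := by simp [hF]
  have hTF : ∀ t h, 0 ≤ t → 0 ≤ h → S.T h (F t) = F (t + h) - F h := by
    intro t h ht hh
    have e1 : S.T h (F t) = ∫ s in (0 : ℝ)..t, S.T h (g s) :=
      (ContinuousLinearMap.intervalIntegral_comp_comm _ (hgc.intervalIntegrable _ _)).symm
    have e2 : ∫ s in (0 : ℝ)..t, S.T h (g s) = ∫ s in (0 : ℝ)..t, g (s + h) := by
      refine intervalIntegral.integral_congr fun s hs => ?_
      rw [uIcc_of_le ht] at hs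
      simp only [hg]
      rw [max_eq_left hs.1, max_eq_left (by linarith [hs.1]), add_comm s h,
        S.semigroup.map_add h s hh hs.1]
      rfl
    rw [e1, e2, intervalIntegral.integral_comp_add_right, zero_add, hF]
    exact (intervalIntegral.integral_interval_sub_left (hgc.intervalIntegrable _ _)
      (hgc.intervalIntegrable _ _)).symm
  have hmem : ∀ t, 0 < t → F t ∈ S.A.domain := by
    intro t ht
    have : (F t, g t - g 0) ∈ (kerRestrict S.opA S.opB).graph := by
      rw [S.generator]
      have h1 := (hasDerivAt_iff_tendsto_slope_zero.1 (hFd t)).mono_left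
        (nhdsWithin_mono 0 (s := Ioi 0) (by intro a ha; exact ne_of_gt ha))
      have h2 := (hasDerivAt_iff_tendsto_slope_zero.1 (hFd 0)).mono_left
        (nhdsWithin_mono 0 (s := Ioi 0) (by intro a ha; exact ne_of_gt ha))
      refine (h1.sub h2).congr' ?_
      filter_upwards [self_mem_nhdsWithin] with h hh
      rw [hTF t h ht.le (le_of_lt hh), hF0, zero_add, sub_zero, ← smul_sub]
      congr 1
      abel
    exact LinearPMap.mem_domain_of_mem_graph this
  have hlim : Tendsto (fun t : ℝ => t⁻¹ • F t) (𝓝[>] 0) (𝓝 x) := by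
    have h2 := (hasDerivAt_iff_tendsto_slope_zero.1 (hFd 0)).mono_left
        (nhdsWithin_mono 0 (s := Ioi 0) (by intro a ha; exact ne_of_gt ha))
    rw [hg0] at h2
    refine h2.congr fun t => ?_
    rw [hF0, zero_add, sub_zero]
  refine mem_closure_of_tendsto hlim ?_
  filter_upwards [self_mem_nhdsWithin] with t ht
  have := S.A.domain.smul_mem ((t⁻¹ : ℝ) : ℂ) (hmem t ht)
  rwa [Complex.coe_smul] at this

theorem denseRange_R : DenseRange ρ.R := by
  refine (dense_domain S).mono fun x hx => ?_
  exact ⟨_, ρ.left_inv ⟨x, hx⟩⟩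

/-- The continuous extension of `(lam - A)⁻¹` to `X₋₁`. -/
def extRL : S.Extrapolation ρ →L[ℂ] X :=
  (⟨S.preR ρ, fun _ => rfl⟩ : S.PreExtrapolation ρ →ₗᵢ[ℂ] X).toContinuousLinearMap.extend
    (S.preι ρ).toContinuousLinearMap

theorem extRL_ι (x : X) : S.extRL ρ (S.ι ρ x) = ρ.R x :=
  ContinuousLinearMap.extend_eq (e := (S.preι ρ).toContinuousLinearMap) _ (S.denseRange_ι ρ)
    (S.preι ρ).isometry.isUniformInducing (S.toPre ρ x)

theorem norm_extRL (z : S.Extrapolation ρ) : ‖S.extRL ρ z‖ = ‖z‖ := by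
  refine (S.denseRange_ι ρ).induction_on z (isClosed_eq (by fun_prop) (by fun_prop)) fun x => ?_
  rw [extRL_ι, norm_ι]

theorem extRL_surjective : Function.Surjective (S.extRL ρ) := by
  have hi : Isometry (S.extRL ρ) :=
    AddMonoidHomClass.isometry_of_norm _ (S.norm_extRL ρ)
  have hc : IsClosed (range (S.extRL ρ)) := hi.isClosedEmbedding.isClosed_range
  have hd : Dense (range (S.extRL ρ)) := (S.denseRange_R ρ).mono (by
    rintro _ ⟨x, rfl⟩
    exact ⟨S.ι ρ x, S.extRL_ι ρ x⟩)
  exact range_eq_univ.1 (hc.closure_eq ▸ hd.closure_eq)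

/-- The extension of `(lam - A)⁻¹` to an isometric isomorphism `X₋₁ → X`. -/
def extR : S.Extrapolation ρ ≃ₗᵢ[ℂ] X :=
  LinearIsometryEquiv.ofSurjective ⟨(S.extRL ρ).toLinearMap, S.norm_extRL ρ⟩
    (S.extRL_surjective ρ)

theorem extR_ι (x : X) : S.extR ρ (S.ι ρ x) = ρ.R x := S.extRL_ι ρ x

/-- `A₋₁ : X → X₋₁`, the bounded extension of `A` (see `Aext_of_mem_domain`; the extension is
unique since `D(A)` is dense): `A₋₁ = lam - (lam - A₋₁)` where `lam - A₋₁ : X → X₋₁` is the inverse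
of the extended resolvent. -/
def Aext : X →L[ℂ] S.Extrapolation ρ :=
  ρ.lam • S.ι ρ - ((S.extR ρ).symm : X ≃L[ℂ] S.Extrapolation ρ).toContinuousLinearMap

theorem Aext_of_mem_domain (x : S.A.domain) : S.Aext ρ (x : X) = S.ι ρ (S.A x) := by
  apply (S.extR ρ).injective
  have h := ρ.left_inv x
  have h1 : S.extR ρ (S.Aext ρ (x : X)) = ρ.lam • ρ.R (x : X) - (x : X) := by
    change S.extR ρ (ρ.lam • S.ι ρ (x : X) - (S.extR ρ).symm (x : X)) = _
    rw [map_sub, map_smul, extR_ι, LinearIsometryEquiv.apply_symm_apply]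
  rw [h1, extR_ι]
  rw [map_sub, map_smul] at h
  rw [sub_eq_iff_eq_add, add_comm, ← sub_eq_iff_eq_add]
  exact h

/-- `T₋₁(t) : X₋₁ → X₋₁`, the bounded extension of `T(t)` (see `Text_ι`; the extension is unique
since `X` is dense in `X₋₁`). -/
def Text (t : ℝ) : S.Extrapolation ρ →L[ℂ] S.Extrapolation ρ :=
  ((S.extR ρ).symm : X ≃L[ℂ] S.Extrapolation ρ).toContinuousLinearMap.comp
    ((S.T t).comp (S.extR ρ : S.Extrapolation ρ ≃L[ℂ] X).toContinuousLinearMap)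

theorem Text_ι (t : ℝ) (ht : 0 ≤ t) (x : X) : S.Text ρ t (S.ι ρ x) = S.ι ρ (S.T t x) := by
  apply (S.extR ρ).injective
  change S.extR ρ ((S.extR ρ).symm (S.T t (S.extR ρ (S.ι ρ x)))) = _
  rw [LinearIsometryEquiv.apply_symm_apply, extR_ι, extR_ι, S.R_comm ρ t ht]

/-! ### Mild solutions -/

/-- `B = 𝔄B₀ - A₋₁B₀ : U → X₋₁`. -/
def B : U →L[ℂ] S.Extrapolation ρ :=
  (S.ι ρ).comp S.AB0L - (S.Aext ρ).comp S.B0L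

/-- `x : [0,∞) → X` is the `X`-valued state trajectory of the linear system with initial value
`x₀` and input `u`: in `X₋₁`,
`x(t) = T(t)x₀ + ∫₀ᵗ T₋₁(t-s) B u(s) ds` for all `t ≥ 0`.
Continuity of `x` in `X` is not required. -/
def IsLinearMildSolution (x₀ : X) (u : ℝ → U) (x : ℝ → X) : Prop :=
  ∀ t : ℝ, 0 ≤ t →
    S.ι ρ (x t) = S.ι ρ (S.T t x₀) + ∫ s in (0 : ℝ)..t, S.Text ρ (t - s) (S.B ρ (u s))

/-- `x` is a (continuous) mild solution on `[0,τ]` of the semilinear system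
`ẋ = 𝔄x + f(t,x)`, `𝔅x = u`, `x(0) = x₀`: `x ∈ C([0,τ];X)` and, in `X₋₁`,
`x(t) = T(t)x₀ + ∫₀ᵗ T₋₁(t-s) [f(s,x(s)) + B u(s)] ds` for all `t ∈ [0,τ]`. -/
def IsMildSolutionOn (f : ℝ → X → X) (τ : ℝ) (x₀ : X) (u : ℝ → U) (x : ℝ → X) : Prop :=
  ContinuousOn x (Icc 0 τ) ∧ ∀ t ∈ Icc 0 τ,
    S.ι ρ (x t) = S.ι ρ (S.T t x₀) +
      ∫ s in (0 : ℝ)..t, S.Text ρ (t - s) (S.ι ρ (f s (x s)) + S.B ρ (u s))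

/-- Global mild solutions of the semilinear system. -/
def IsGlobalMildSolution (f : ℝ → X → X) (x₀ : X) (u : ℝ → U) (x : ℝ → X) : Prop :=
  ∀ τ : ℝ, 0 < τ → S.IsMildSolutionOn ρ f τ x₀ u x

end BoundaryControlSystem

/-! ### Input-to-state stability -/

/-- `𝒵`-input-to-state stability of a system given by its solution relation `Sol x₀ u x`
("`x : [0,∞) → X` is a solution for the initial value `x₀` and the input `u`"):
for all `(x₀,u) ∈ X × 𝒵_loc(ℝ₊;U)` there is a unique solution on `[0,∞)`, and there are
`β ∈ 𝒦ℒ`, `γ ∈ 𝒦` with `‖x(t)‖ ≤ β(‖x₀‖,t) + γ(‖u‖_{𝒵([0,t];U)})` for all `t > 0`. -/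
def IsISS {X U : Type*} [NormedAddCommGroup X] [NormedAddCommGroup U] (Z : InputClass)
    (Sol : X → (ℝ → U) → (ℝ → X) → Prop) : Prop :=
  (∀ (x₀ : X) (u : ℝ → U), Z.MemLoc u →
    ∃ x : ℝ → X, Sol x₀ u x ∧ ∀ y : ℝ → X, Sol x₀ u y → EqOn y x (Ici 0)) ∧
  ∃ (β : ℝ → ℝ → ℝ) (γ : ℝ → ℝ), IsClassKL β ∧ IsClassK γ ∧
    ∀ (x₀ : X) (u : ℝ → U) (x : ℝ → X), Z.MemLoc u → Sol x₀ u x →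
      ∀ t : ℝ, 0 < t → ‖x t‖ ≤ β ‖x₀‖ t + γ (Z.normOn t u)

end

/-! The isometric isomorphism `extR` from `X₋₁` onto `X` commutes with the semigroup and with
Bochner integrals. Every equation in `X₋₁` thus becomes one in `X` with the injective operator `R`
applied to the unknown, and the extrapolation space disappears (`IsTraj`, `isMildSolutionOn_iff`).

For zero initial value the linear equation is homogeneous in `(u, z)`. Scaling the input to norm one
in the ISS estimate therefore gives `‖z t‖ ≤ γ 1 * ‖u‖`: the control operator is admissible with a
constant that does not depend on time (`exists_isAdmissible_of_isISS`). Exponential decay turns this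
into a time-independent bound by the essential supremum of the input
(`IsAdmissible.exists_norm_le_of_ae_bound`).

Linear ISS does not ask for continuous trajectories, while mild solutions must be continuous.
Continuity follows from admissibility by density and translation (`IsAdmissible.continuousOn`).

The semilinear problem then reads `x = T x₀ + z + T * f(·, x)` in `X`. As the kernel `M Lf exp (ω
t)` has total mass `M Lf / -ω < 1`, the fixed point map is a contraction on every `C([0,τ];X)`
(`exists_solution_of_lipschitz`). The same smallness gives a comparison principle
(`le_exp_of_le_integral_exp`), from which uniqueness and both estimates follow, with decay rate `ω +
M Lf` and gain multiplied by `ω / (ω + M Lf)`. -/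

/-! ### Convolution with a bounded strongly continuous semigroup -/

namespace IsC0Semigroup

variable {X : Type*} [NormedAddCommGroup X] [NormedSpace ℂ X]
  {T : ℝ → X →L[ℂ] X} {K : ℝ}

theorem norm_le_of_exp {M ω : ℝ} (hM : ∀ t, 0 ≤ t → ‖T t‖ ≤ M * Real.exp (ω * t)) (hω : ω < 0)
    {t : ℝ} (ht : 0 ≤ t) : ‖T t‖ ≤ M := by
  have hM0 : 0 ≤ M := by
    have := (norm_nonneg _).trans (hM 0 le_rfl)
    simpa using this
  refine (hM t ht).trans (mul_le_of_le_one_right hM0 (Real.exp_le_one_iff.2 ?_))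
  nlinarith

/-- Strong continuity in time and a common Lipschitz constant in the vector give joint continuity.
The clamp `max · 0` is needed because `T` is arbitrary at negative times. -/
theorem continuous_max (hT : IsC0Semigroup T) (hK : ∀ t, 0 ≤ t → ‖T t‖ ≤ K) :
    Continuous fun p : ℝ × X => T (max p.1 0) p.2 := by
  refine (continuous_prod_of_continuous_lipschitzWith
    (fun p : X × ℝ => T (max p.2 0) p.1) K.toNNReal ?_ ?_).comp continuous_swap
  · intro x
    exact (hT.continuousOn x).comp_continuous (by fun_prop) fun s => mem_Ici.2 (le_max_right _ _)
  · intro t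
    refine (T (max t 0)).lipschitz.weaken ?_
    rw [← NNReal.coe_le_coe, coe_nnnorm]
    exact (hK _ (le_max_right _ _)).trans (Real.le_coe_toNNReal K)

theorem map_add_apply (hT : IsC0Semigroup T) {s t : ℝ} (hs : 0 ≤ s) (ht : 0 ≤ t) (x : X) :
    T (s + t) x = T s (T t x) := by
  rw [hT.map_add s t hs ht]; rfl

/-- The kernel time `r` may exceed the endpoint `t`, as happens in `IsTraj.shift` when an integral
up to `t + h` is split at `h`. -/
theorem intervalIntegrable_conv (hT : IsC0Semigroup T) (hK : ∀ t, 0 ≤ t → ‖T t‖ ≤ K)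
    {g : ℝ → X} {t r : ℝ} (ht : 0 ≤ t) (htr : t ≤ r) (hg : IntegrableOn g (Icc 0 t)) :
    IntervalIntegrable (fun s => T (r - s) (g s)) volume 0 t := by
  rw [intervalIntegrable_iff_integrableOn_Icc_of_le ht]
  have hm : AEStronglyMeasurable (fun s => T (max (r - s) 0) (g s))
      (volume.restrict (Icc 0 t)) :=
    (hT.continuous_max hK).comp_aestronglyMeasurable
      ((Continuous.aestronglyMeasurable (by fun_prop : Continuous fun s : ℝ => r - s)).prodMk
        hg.aestronglyMeasurable)
  have hi : IntegrableOn (fun s => T (max (r - s) 0) (g s)) (Icc 0 t) := by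
    refine (hg.norm.const_mul K).mono' hm (Eventually.of_forall fun s => ?_)
    exact (T _).le_of_opNorm_le (hK _ (le_max_right _ _)) _
  refine hi.congr_fun (fun s hs => ?_) measurableSet_Icc
  simp only
  rw [max_eq_left (by linarith [hs.2])]

theorem conv_eq_max {g : ℝ → X} {t : ℝ} (ht : 0 ≤ t) :
    ∫ s in (0 : ℝ)..t, T (t - s) (g s) = ∫ s in (0 : ℝ)..t, T (max (t - s) 0) (g s) := by
  refine intervalIntegral.integral_congr fun s hs => ?_
  rw [uIcc_of_le ht] at hs
  rw [max_eq_left (by linarith [hs.2])]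

theorem continuous_conv (hT : IsC0Semigroup T) (hK : ∀ t, 0 ≤ t → ‖T t‖ ≤ K)
    {g : ℝ → X} (hg : Continuous g) :
    Continuous fun t : ℝ => ∫ s in (0 : ℝ)..t, T (max (t - s) 0) (g s) := by
  refine intervalIntegral.continuous_parametric_intervalIntegral_of_continuous ?_ continuous_id
  exact (hT.continuous_max hK).comp
    (by fun_prop : Continuous fun p : ℝ × ℝ => (p.1 - p.2, g p.2))

theorem continuous_integral [CompleteSpace X] (hT : IsC0Semigroup T)
    (hK : ∀ t, 0 ≤ t → ‖T t‖ ≤ K) (y : X) :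
    Continuous fun t : ℝ => ∫ s in (0 : ℝ)..t, T (max s 0) y := by
  refine intervalIntegral.continuous_primitive (fun a b => ?_) 0
  exact ((hT.continuous_max hK).comp
    (by fun_prop : Continuous fun s : ℝ => (s, y))).intervalIntegrable _ _

/-- `T(t)x - x = ∫₀ᵗ T(s)Ax ds` for `x` in the domain of the generator `A`. -/
theorem sub_eq_integral [CompleteSpace X] (hT : IsC0Semigroup T)
    (hK : ∀ t, 0 ≤ t → ‖T t‖ ≤ K) {x y : X}
    (hxy : Tendsto (fun h : ℝ => h⁻¹ • (T h x - x)) (𝓝[>] 0) (𝓝 y)) {t : ℝ} (ht : 0 ≤ t) :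
    T t x - x = ∫ s in (0 : ℝ)..t, T s y := by
  have hcont : ∀ z, Continuous fun s : ℝ => T (max s 0) z := fun z =>
    (hT.continuous_max hK).comp (by fun_prop : Continuous fun s : ℝ => (s, z))
  have h1 : ∫ s in (0 : ℝ)..t, T s y = ∫ s in (0 : ℝ)..t, T (max s 0) y := by
    refine intervalIntegral.integral_congr fun s hs => ?_
    rw [uIcc_of_le ht] at hs
    rw [max_eq_left hs.1]
  -- The generator only provides right derivatives, which suffice for the fundamental theorem of
  -- calculus with a continuous orbit.
  have h2 := intervalIntegral.integral_eq_sub_of_hasDeriv_right (a := 0) (b := t)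
    (f := fun s => T (max s 0) x) (f' := fun s => T (max s 0) y) (hcont x).continuousOn ?_
    ((hcont y).intervalIntegrable _ _)
  · rw [h1, h2, max_self, max_eq_left ht, hT.map_zero]
    rfl
  · intro s hs
    rw [min_eq_left ht, max_eq_right ht] at hs
    have hs0 : 0 ≤ s := hs.1.le
    rw [hasDerivWithinAt_iff_tendsto_slope' (by simp)]
    have hmap : Tendsto (fun r : ℝ => r - s) (𝓝[>] s) (𝓝[>] 0) := by
      refine tendsto_nhdsWithin_iff.2 ⟨?_, ?_⟩
      · have : Tendsto (fun r : ℝ => r - s) (𝓝 s) (𝓝 (s - s)) :=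
          (continuous_id.sub continuous_const).tendsto s
        rw [sub_self] at this
        exact this.mono_left nhdsWithin_le_nhds
      · filter_upwards [self_mem_nhdsWithin] with r hr
        exact mem_Ioi.2 (sub_pos.2 (mem_Ioi.1 hr))
    rw [max_eq_left hs0]
    refine (((T s).continuous.tendsto _).comp (hxy.comp hmap)).congr' ?_
    filter_upwards [self_mem_nhdsWithin] with r hr
    have hr' : 0 ≤ r - s := (sub_pos.2 (mem_Ioi.1 hr)).le
    have e : T r x = T s (T (r - s) x) := by
      rw [← hT.map_add_apply hs0 hr', add_sub_cancel]
    simp only [Function.comp_apply, slope, vsub_eq_sub]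
    rw [max_eq_left hs0, max_eq_left (by linarith), e, ← map_sub]
    exact ((T s).restrictScalars ℝ).map_smul _ _

theorem conv_const {y : X} {t : ℝ} :
    ∫ s in (0 : ℝ)..t, T (t - s) y = ∫ s in (0 : ℝ)..t, T s y := by
  rw [intervalIntegral.integral_comp_sub_left (fun s => T s y) t, sub_self, sub_zero]

end IsC0Semigroup

/-! ### Trajectories with zero initial value -/

section Trajectories

variable {X U : Type*} [NormedAddCommGroup X] [NormedSpace ℂ X]
  [NormedAddCommGroup U] [NormedSpace ℂ U]

/-- `R z(t) = ∫₀ᵗ T(t-s) G u(s) ds` for all `t ∈ [0,τ]`. -/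
def IsTraj (T : ℝ → X →L[ℂ] X) (R : X →L[ℂ] X) (G : U →L[ℂ] X) (τ : ℝ) (u : ℝ → U)
    (z : ℝ → X) : Prop :=
  ∀ t ∈ Icc 0 τ, R (z t) = ∫ s in (0 : ℝ)..t, T (t - s) (G (u s))

variable {T : ℝ → X →L[ℂ] X} {R : X →L[ℂ] X} {G : U →L[ℂ] X} {K τ : ℝ} {u v : ℝ → U}
  {z w : ℝ → X}

namespace IsTraj

theorem mono {τ' : ℝ} (h : IsTraj T R G τ u z) (hτ : τ' ≤ τ) : IsTraj T R G τ' u z :=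
  fun t ht => h t ⟨ht.1, ht.2.trans hτ⟩

theorem congr_ae (h : IsTraj T R G τ u z)
    (huv : ∀ᵐ s ∂(volume.restrict (Icc 0 τ)), u s = v s) : IsTraj T R G τ v z := by
  intro t ht
  rw [h t ht]
  refine intervalIntegral.integral_congr_ae ?_
  rw [ae_restrict_iff' measurableSet_Icc] at huv
  filter_upwards [huv] with s hs hst
  rw [uIoc_of_le ht.1] at hst
  rw [hs ⟨hst.1.le, hst.2.trans ht.2⟩]

theorem congr (h : IsTraj T R G τ u z) (huv : EqOn u v (Icc 0 τ)) : IsTraj T R G τ v z :=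
  h.congr_ae (ae_restrict_of_forall_mem measurableSet_Icc huv)

theorem eqOn (hR : Function.Injective R) (h : IsTraj T R G τ u z) (h' : IsTraj T R G τ u w) :
    EqOn z w (Icc 0 τ) :=
  fun t ht => hR ((h t ht).trans (h' t ht).symm)

theorem map_zero (hR : Function.Injective R) (hτ : 0 ≤ τ) (h : IsTraj T R G τ u z) :
    z 0 = 0 := by
  apply hR
  rw [h 0 ⟨le_rfl, hτ⟩, intervalIntegral.integral_same, _root_.map_zero]

theorem intervalIntegrable (hT : IsC0Semigroup T) (hK : ∀ t, 0 ≤ t → ‖T t‖ ≤ K)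
    (hu : IntegrableOn u (Icc 0 τ)) {t r : ℝ} (ht : t ∈ Icc 0 τ) (htr : t ≤ r) :
    IntervalIntegrable (fun s => T (r - s) (G (u s))) volume 0 t :=
  hT.intervalIntegrable_conv hK ht.1 htr
    (G.integrable_comp (hu.mono_set (Icc_subset_Icc_right ht.2)))

theorem add (hT : IsC0Semigroup T) (hK : ∀ t, 0 ≤ t → ‖T t‖ ≤ K)
    (hu : IntegrableOn u (Icc 0 τ)) (hv : IntegrableOn v (Icc 0 τ))
    (h : IsTraj T R G τ u z) (h' : IsTraj T R G τ v w) :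
    IsTraj T R G τ (fun s => u s + v s) (fun t => z t + w t) := by
  intro t ht
  simp only [map_add]
  rw [h t ht, h' t ht, intervalIntegral.integral_add
    (intervalIntegrable hT hK hu ht le_rfl) (intervalIntegrable hT hK hv ht le_rfl)]

theorem sub (hT : IsC0Semigroup T) (hK : ∀ t, 0 ≤ t → ‖T t‖ ≤ K)
    (hu : IntegrableOn u (Icc 0 τ)) (hv : IntegrableOn v (Icc 0 τ))
    (h : IsTraj T R G τ u z) (h' : IsTraj T R G τ v w) :
    IsTraj T R G τ (fun s => u s - v s) (fun t => z t - w t) := by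
  intro t ht
  simp only [map_sub]
  rw [h t ht, h' t ht, intervalIntegral.integral_sub
    (intervalIntegrable hT hK hu ht le_rfl) (intervalIntegrable hT hK hv ht le_rfl)]

theorem const_smul (h : IsTraj T R G τ u z) (c : ℂ) :
    IsTraj T R G τ (fun s => c • u s) (fun t => c • z t) := by
  intro t ht
  simp only [map_smul]
  rw [h t ht, intervalIntegral.integral_smul]

/-- Cocycle property: the integral up to `t + h` is split at `h`. On the first part `T (t + h - s) =
T t ∘ T (h - s)`; the second part is a translation. -/
theorem shift [CompleteSpace X] (hT : IsC0Semigroup T) (hK : ∀ t, 0 ≤ t → ‖T t‖ ≤ K)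
    (hR : Function.Injective R) (hRT : ∀ t, 0 ≤ t → ∀ y, R (T t y) = T t (R y))
    (hu : IntegrableOn u (Icc 0 τ)) {h t : ℝ} (hh : 0 ≤ h) (ht : 0 ≤ t) (hth : t + h ≤ τ)
    (hz : IsTraj T R G τ u z) (hw : IsTraj T R G t (fun s => u (s + h)) w) :
    z (t + h) = w t + T t (z h) := by
  apply hR
  have h1 : IntervalIntegrable (fun s => T (t + h - s) (G (u s))) volume 0 h :=
    intervalIntegrable hT hK hu ⟨hh, by linarith⟩ (by linarith)
  have h2 : IntervalIntegrable (fun s => T (t + h - s) (G (u s))) volume 0 (t + h) :=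
    intervalIntegrable hT hK hu ⟨by linarith, hth⟩ le_rfl
  have h3 : IntervalIntegrable (fun s => T (h - s) (G (u s))) volume 0 h :=
    intervalIntegrable hT hK hu ⟨hh, by linarith⟩ le_rfl
  have e1 : ∫ s in (0 : ℝ)..t, T (t - s) (G (u (s + h))) =
      ∫ s in h..(t + h), T (t + h - s) (G (u s)) := by
    rw [← zero_add h, ← add_assoc, add_zero, ← intervalIntegral.integral_comp_add_right]
    refine intervalIntegral.integral_congr fun s _ => ?_
    simp only [zero_add, add_sub_add_right_eq_sub]
  have e2 : ∫ s in (0 : ℝ)..h, T (t + h - s) (G (u s)) = T t (R (z h)) := by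
    rw [hz h ⟨hh, by linarith⟩, ← ContinuousLinearMap.intervalIntegral_comp_comm _ h3]
    refine intervalIntegral.integral_congr fun s hs => ?_
    rw [uIcc_of_le hh] at hs
    rw [add_sub_assoc, hT.map_add_apply ht (by linarith [hs.2])]
  rw [hz _ ⟨by linarith, hth⟩, map_add, hRT t ht, hw t ⟨ht, le_rfl⟩, e1, ← e2,
    ← intervalIntegral.integral_add_adjacent_intervals h1 (h1.symm.trans h2)]
  exact add_comm _ _

/-- Delaying a constant input delays its trajectory; before time `a` the clamp returns `z 0 = 0`.
Continuity in time is thus inherited although the input jumps. -/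
theorem heaviside {c : U} {a : ℝ} (ha : 0 ≤ a) (hR : Function.Injective R)
    (hz : ∀ τ, IsTraj T R G τ (fun _ => c) z) :
    IsTraj T R G τ ((Ioi a).indicator fun _ => c) (fun t => z (max (t - a) 0)) := by
  intro t ht
  simp only
  rcases le_total t a with hta | hta
  · rw [max_eq_right (by linarith), (hz 0).map_zero hR le_rfl, _root_.map_zero]
    refine (intervalIntegral.integral_zero_ae (Eventually.of_forall fun s hs => ?_)).symm
    rw [uIoc_of_le ht.1] at hs
    rw [indicator_of_notMem (fun h : s ∈ Ioi a => not_lt.2 (hs.2.trans hta) (mem_Ioi.1 h)), _root_.map_zero,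
      _root_.map_zero]
  · rw [max_eq_left (by linarith), hz (t - a) (t - a) ⟨by linarith, le_rfl⟩]
    have e : (fun s => T (t - s) (G ((Ioi a).indicator (fun _ => c) s))) =
        (Ioi a).indicator fun s => T (t - s) (G c) := by
      funext s
      by_cases hs : s ∈ Ioi a
      · simp only [indicator_of_mem hs]
      · simp only [indicator_of_notMem hs, _root_.map_zero]
    rw [e, intervalIntegral.integral_comp_sub_left (fun s => T s (G c)),
      intervalIntegral.integral_of_le ht.1, setIntegral_indicator measurableSet_Ioi,
      show Ioc 0 t ∩ Ioi a = Ioc a t by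
        ext s; simp only [mem_inter_iff, mem_Ioc, mem_Ioi]
        exact ⟨fun h => ⟨h.2, h.1.2⟩, fun h => ⟨⟨by linarith [h.1], h.2⟩, h.1⟩⟩,
      ← intervalIntegral.integral_of_le hta,
      intervalIntegral.integral_comp_sub_left (fun s => T s (G c))]
    simp

end IsTraj

end Trajectories

/-! ### Step functions, regulated functions and the input classes -/

theorem exists_partition_avoiding {τ : ℝ} (hτ : 0 ≤ τ) (F : Finset ℝ) :
    ∃ (n : ℕ) (a : ℕ → ℝ), Monotone a ∧ a 0 = 0 ∧ a n = τ ∧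
      ∀ i, i < n → ∀ s ∈ Ioo (a i) (a (i + 1)), s ∉ F := by
  induction F using Finset.induction_on with
  | empty =>
    refine ⟨1, fun i => if i = 0 then 0 else τ, ?_, by simp, by simp, by simp⟩
    refine monotone_nat_of_le_succ fun i => ?_
    simp only [Nat.succ_ne_zero, if_false]
    split_ifs
    exacts [hτ, le_rfl]
  | insert q F _ ih =>
    obtain ⟨n, a, ha, ha0, han, haF⟩ := ih
    set p : ℝ := max 0 (min τ q) with hp
    have hp0 : 0 ≤ p := le_max_left _ _
    have hpτ : p ≤ τ := max_le hτ (min_le_left _ _)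
    -- The partition is run through twice, first cut from above at `p`, the projection of `q` to
    -- `[0,τ]`, then from below. The cell joining the two runs is degenerate, since both its ends
    -- equal `p`.
    set b : ℕ → ℝ := fun k => if k ≤ n then min (a k) p else max (a (k - (n + 1))) p with hb
    have hb1 : ∀ k, k ≤ n → b k = min (a k) p := fun k hk => if_pos hk
    have hb2 : ∀ k, b (k + (n + 1)) = max (a k) p := fun k => by
      simp only [hb]
      rw [if_neg (by omega), Nat.add_sub_cancel]
    have hbn : ∀ k, n < k → ∃ j, k = j + (n + 1) := fun k hk => ⟨k - (n + 1), by omega⟩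
    refine ⟨n + (n + 1), b, ?_, ?_, ?_, ?_⟩
    · refine monotone_nat_of_le_succ fun k => ?_
      rcases lt_trichotomy k n with h | h | h
      · rw [hb1 k h.le, hb1 (k + 1) h]
        exact min_le_min_right _ (ha k.le_succ)
      · subst h
        have := hb2 0
        rw [zero_add] at this
        rw [hb1 k le_rfl, this]
        exact (min_le_right _ _).trans (le_max_right _ _)
      · obtain ⟨j, rfl⟩ := hbn k h
        rw [hb2, show j + (n + 1) + 1 = (j + 1) + (n + 1) by omega, hb2]
        exact max_le_max_right _ (ha j.le_succ)
    · rw [hb1 0 (Nat.zero_le _), ha0, min_eq_left hp0]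
    · rw [hb2, han, max_eq_left hpτ]
    · intro k hk s hs
      have key : ∀ j < n, a j < s → s < a (j + 1) → s ≠ p → s ∉ insert q F := by
        intro j hj h1 h2 h3 hmem
        rcases Finset.mem_insert.1 hmem with rfl | hF
        · refine h3 ?_
          have hs0 : 0 ≤ s := (ha0 ▸ ha (Nat.zero_le j)).trans h1.le
          have hsτ : s ≤ τ := h2.le.trans (han ▸ ha hj)
          rw [hp, min_eq_right hsτ, max_eq_right hs0]
        · exact haF j hj s ⟨h1, h2⟩ hF
      rcases lt_trichotomy k n with h | h | h
      · rw [hb1 k h.le, hb1 (k + 1) h] at hs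
        obtain ⟨h4, h5⟩ := lt_min_iff.1 hs.2
        exact key k h ((min_lt_iff.1 hs.1).resolve_right (not_lt.2 h5.le)) h4 h5.ne
      · subst h
        have := hb2 0
        rw [zero_add] at this
        rw [hb1 k le_rfl, this, han, ha0, min_eq_right hpτ, max_eq_right hp0] at hs
        exact absurd (hs.1.trans hs.2) (lt_irrefl _)
      · obtain ⟨j, rfl⟩ := hbn k h
        rw [hb2, show j + (n + 1) + 1 = (j + 1) + (n + 1) by omega, hb2] at hs
        obtain ⟨h4, h5⟩ := max_lt_iff.1 hs.1
        exact key j (by omega) h4 ((lt_max_iff.1 hs.2).resolve_right (not_lt.2 h5.le)) h5.ne'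

/-- The cell of a partition of `[0,τ]` that contains a given point. -/
theorem exists_partition_cell {n : ℕ} {a : ℕ → ℝ} {s : ℝ} (h0 : a 0 ≤ s) (hn : s < a n) :
    ∃ i < n, a i ≤ s ∧ s < a (i + 1) := by
  classical
  have hex : ∃ k, s < a k := ⟨n, hn⟩
  have hpos : Nat.find hex ≠ 0 := fun h => by
    have := Nat.find_spec hex
    rw [h] at this
    exact absurd this (not_lt.2 h0)
  obtain ⟨i, hi⟩ := Nat.exists_eq_succ_of_ne_zero hpos
  refine ⟨i, ?_, not_lt.1 (Nat.find_min hex (by omega)), ?_⟩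
  · have := Nat.find_min' hex hn
    omega
  · have := Nat.find_spec hex
    rwa [hi] at this

section StepFunctions

variable {U : Type*} [NormedAddCommGroup U] {τ : ℝ} {u v g g' : ℝ → U}

/-- Step functions are those constant on every interval that misses some finite set. -/
theorem isStepOn_iff (hτ : 0 ≤ τ) : IsStepOn τ g ↔ ∃ F : Finset ℝ, ∀ s t, s < t → 0 ≤ s → t ≤ τ →
    (∀ r ∈ Ioo s t, r ∉ F) → ∃ c : U, ∀ r ∈ Ioo s t, g r = c := by
  constructor
  · rintro ⟨n, a, ha, ha0, han, hc⟩
    refine ⟨(Finset.range (n + 1)).image a, fun s t hst hs ht hF => ?_⟩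
    obtain ⟨i, hi, h1, h2⟩ := exists_partition_cell (n := n) (a := a) (s := (s + t) / 2)
      (by linarith) (by linarith)
    obtain ⟨c, hc⟩ := hc i hi
    have hmem : ∀ j ≤ n, a j ∉ Ioo s t := fun j hj h =>
      hF _ h (Finset.mem_image_of_mem _ (Finset.mem_range.2 (by omega)))
    have h3 : a i ≤ s := not_lt.1 fun h => hmem i hi.le ⟨h, by linarith⟩
    have h4 : t ≤ a (i + 1) := not_lt.1 fun h => hmem (i + 1) hi ⟨by linarith, h⟩
    exact ⟨c, fun r hr => hc r ⟨by linarith [hr.1], by linarith [hr.2]⟩⟩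
  · rintro ⟨F, hF⟩
    obtain ⟨n, a, ha, ha0, han, hc⟩ := exists_partition_avoiding hτ F
    refine ⟨n, a, ha, ha0, han, fun i hi => ?_⟩
    rcases (ha i.le_succ).lt_or_eq with h | h
    · exact hF _ _ h (ha0 ▸ ha (Nat.zero_le i)) (han ▸ ha hi) (hc i hi)
    · refine ⟨0, fun s hs => ?_⟩
      exact absurd (hs.1.trans hs.2) (by rw [← Nat.succ_eq_add_one, ← h]; exact lt_irrefl _)

/-- With exceptional finite sets in place of ordered partitions, a common refinement is just a
union. -/
theorem IsStepOn.sub (hτ : 0 ≤ τ) (hg : IsStepOn τ g) (hg' : IsStepOn τ g') :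
    IsStepOn τ (fun s => g s - g' s) := by
  classical
  rw [isStepOn_iff hτ] at hg hg' ⊢
  obtain ⟨F, hF⟩ := hg
  obtain ⟨F', hF'⟩ := hg'
  refine ⟨F ∪ F', fun s t hst hs ht h => ?_⟩
  obtain ⟨c, hc⟩ := hF s t hst hs ht fun r hr hm => h r hr (Finset.mem_union_left _ hm)
  obtain ⟨c', hc'⟩ := hF' s t hst hs ht fun r hr hm => h r hr (Finset.mem_union_right _ hm)
  exact ⟨c - c', fun r hr => by rw [hc r hr, hc' r hr]⟩

theorem IsStepOn.comp_min (hτ : 0 ≤ τ) (hg : IsStepOn τ g) {τ' : ℝ} (hτ' : 0 ≤ τ') :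
    IsStepOn τ' (fun s => g (min s τ)) := by
  classical
  rw [isStepOn_iff hτ] at hg
  rw [isStepOn_iff hτ']
  obtain ⟨F, hF⟩ := hg
  refine ⟨insert τ F, fun s t hst hs ht h => ?_⟩
  rcases le_or_gt t τ with h1 | h1
  · obtain ⟨c, hc⟩ := hF s t hst hs h1 fun r hr hm => h r hr (Finset.mem_insert_of_mem hm)
    exact ⟨c, fun r hr => by rw [min_eq_left (hr.2.le.trans h1)]; exact hc r hr⟩
  · have h2 : τ ≤ s := not_lt.1 fun h2 => h τ ⟨h2, h1⟩ (Finset.mem_insert_self _ _)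
    exact ⟨g τ, fun r hr => by rw [min_eq_right (h2.trans hr.1.le)]⟩

theorem IsRegulatedOn.sub (hτ : 0 ≤ τ) (hu : IsRegulatedOn τ u) (hv : IsRegulatedOn τ v) :
    IsRegulatedOn τ (fun s => u s - v s) := by
  intro ε hε
  obtain ⟨g, hg, hug⟩ := hu (ε / 2) (by linarith)
  obtain ⟨g', hg', hvg⟩ := hv (ε / 2) (by linarith)
  refine ⟨_, hg.sub hτ hg', fun s hs => ?_⟩
  calc ‖u s - v s - (g s - g' s)‖ = ‖(u s - g s) - (v s - g' s)‖ := by congr 1; abel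
    _ ≤ ‖u s - g s‖ + ‖v s - g' s‖ := norm_sub_le _ _
    _ ≤ ε := by linarith [hug s hs, hvg s hs]

theorem IsRegulatedOn.comp_min (hτ : 0 ≤ τ) (hu : IsRegulatedOn τ u) {τ' : ℝ} (hτ' : 0 ≤ τ') :
    IsRegulatedOn τ' (fun s => u (min s τ)) := by
  intro ε hε
  obtain ⟨g, hg, hug⟩ := hu ε hε
  exact ⟨_, hg.comp_min hτ hτ', fun s hs => hug _ ⟨le_min hs.1 hτ, min_le_right _ _⟩⟩

theorem IsStepOn.isRegulatedOn (hg : IsStepOn τ g) : IsRegulatedOn τ g :=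
  fun ε hε => ⟨g, hg, fun s _ => by rw [sub_self, norm_zero]; exact hε.le⟩

theorem IsRegulatedOn.const_smul [NormedSpace ℂ U] (hu : IsRegulatedOn τ u) (k : ℂ) :
    IsRegulatedOn τ (fun s => k • u s) := by
  intro ε hε
  have hk : 0 < ‖k‖ + 1 := by positivity
  obtain ⟨g, ⟨n, a, ha, ha0, han, hc⟩, hug⟩ := hu (ε / (‖k‖ + 1)) (by positivity)
  refine ⟨fun s => k • g s, ⟨n, a, ha, ha0, han, fun i hi => ?_⟩, fun s hs => ?_⟩
  · obtain ⟨c, hc⟩ := hc i hi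
    exact ⟨k • c, fun s hs => by simp only [hc s hs]⟩
  · rw [← smul_sub, norm_smul]
    have := hug s hs
    rw [le_div_iff₀ hk] at this
    nlinarith [norm_nonneg (u s - g s)]

/-- A step function is almost everywhere a linear combination of Heaviside functions. -/
theorem IsStepOn.exists_sum_heaviside (hg : IsStepOn τ g) :
    ∃ (n : ℕ) (a : ℕ → ℝ) (c : ℕ → U), (∀ i, 0 ≤ a i) ∧
      ∀ᵐ s ∂(volume.restrict (Icc 0 τ)), g s = ∑ i ∈ Finset.range n,
        ((Ioi (a i)).indicator (fun _ => c i) s - (Ioi (a (i + 1))).indicator (fun _ => c i) s) := by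
  classical
  obtain ⟨n, a, ha, ha0, han, hc⟩ := hg
  choose! c hc using hc
  refine ⟨n, a, c, fun i => ha0 ▸ ha (Nat.zero_le i), ?_⟩
  have hnull : ∀ᵐ s ∂(volume : Measure ℝ), s ∉ a '' Finset.range (n + 1) :=
    (((Finset.range (n + 1)).finite_toSet.image a).countable.ae_notMem volume)
  rw [ae_restrict_iff' measurableSet_Icc]
  filter_upwards [hnull] with s hs hsI
  have hne : ∀ j ≤ n, a j ≠ s := fun j hj h =>
    hs ⟨j, Finset.mem_coe.2 (Finset.mem_range.2 (by omega)), h⟩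
  obtain ⟨i, hi, h1, h2⟩ := exists_partition_cell (n := n) (a := a) (s := s)
    (ha0 ▸ hsI.1) (lt_of_le_of_ne (han ▸ hsI.2) (hne n le_rfl).symm)
  have h1' : a i < s := lt_of_le_of_ne h1 (hne i hi.le)
  rw [hc i hi s ⟨h1', h2⟩, Finset.sum_eq_single i]
  · rw [indicator_of_mem (mem_Ioi.2 h1'),
      indicator_of_notMem (fun h : s ∈ Ioi _ => not_lt.2 h2.le (mem_Ioi.1 h)), sub_zero]
  · intro j _ hji
    rcases lt_or_gt_of_ne hji with h | h
    · have h3 : a (j + 1) < s := (ha h).trans_lt h1'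
      rw [indicator_of_mem (mem_Ioi.2 h3),
        indicator_of_mem (mem_Ioi.2 ((ha j.le_succ).trans_lt h3)), sub_self]
    · have h3 : s < a j := h2.trans_le (ha h)
      rw [indicator_of_notMem (fun h : s ∈ Ioi _ => not_lt.2 h3.le (mem_Ioi.1 h)),
        indicator_of_notMem (fun h : s ∈ Ioi _ =>
          not_lt.2 (h3.le.trans (ha j.le_succ)) (mem_Ioi.1 h)), sub_self]
  · exact fun h => absurd (Finset.mem_range.2 hi) h

theorem IsStepOn.memLp_top (hg : IsStepOn τ g) : MemLp g ∞ (volume.restrict (Icc 0 τ)) := by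
  obtain ⟨n, a, c, -, h⟩ := hg.exists_sum_heaviside
  refine MemLp.ae_eq (EventuallyEq.symm h) ?_
  refine memLp_finsetSum _ fun i _ => ?_
  exact ((memLp_top_const (c i)).indicator measurableSet_Ioi).sub
    ((memLp_top_const (c i)).indicator measurableSet_Ioi)

theorem IsRegulatedOn.memLp_top (hu : IsRegulatedOn τ u) :
    MemLp u ∞ (volume.restrict (Icc 0 τ)) := by
  choose g hg hug using fun k : ℕ => hu (1 / ((k : ℝ) + 1)) Nat.one_div_pos_of_nat
  have hm : AEStronglyMeasurable u (volume.restrict (Icc 0 τ)) := by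
    refine aestronglyMeasurable_of_tendsto_ae atTop (fun k => (hg k).memLp_top.1)
      (ae_restrict_of_forall_mem measurableSet_Icc fun s hs => ?_)
    rw [tendsto_iff_norm_sub_tendsto_zero]
    refine squeeze_zero (fun _ => norm_nonneg _) (fun k => ?_)
      tendsto_one_div_add_atTop_nhds_zero_nat
    rw [norm_sub_rev]
    exact hug k s hs
  -- `g 0` is within distance `1` of `u`, so boundedness passes from the step function to `u`.
  have hd : MemLp (u - g 0) ∞ (volume.restrict (Icc 0 τ)) :=
    memLp_top_of_bound (hm.sub (hg 0).memLp_top.1) _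
      (ae_restrict_of_forall_mem measurableSet_Icc (hug 0))
  simpa using hd.add (hg 0).memLp_top

end StepFunctions

namespace InputClass

variable {U : Type*} [NormedAddCommGroup U] {Z : InputClass} {τ t : ℝ} {u v : ℝ → U}

theorem one_le_exponent (Z : InputClass) : 1 ≤ Z.exponent := by
  cases Z with
  | Lq q h _ => exact h
  | C => exact le_top
  | Reg => exact le_top

theorem MemOn.memLp (hu : Z.MemOn τ u) : MemLp u Z.exponent (volume.restrict (Icc 0 τ)) := by
  cases Z with
  | Lq q h _ => exact hu
  | C =>
    obtain ⟨B, hB⟩ := isCompact_Icc.exists_bound_of_continuousOn (ContinuousOn.norm hu)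
    exact memLp_top_of_bound
      (ContinuousOn.aestronglyMeasurable_of_isCompact hu isCompact_Icc measurableSet_Icc) B
      (ae_restrict_of_forall_mem measurableSet_Icc fun s hs => by simpa using hB s hs)
  | Reg => exact IsRegulatedOn.memLp_top hu

theorem MemOn.integrableOn (hu : Z.MemOn τ u) : IntegrableOn u (Icc 0 τ) :=
  hu.memLp.integrable Z.one_le_exponent

theorem MemOn.sub (hτ : 0 ≤ τ) (hu : Z.MemOn τ u) (hv : Z.MemOn τ v) :
    Z.MemOn τ (fun s => u s - v s) := by
  cases Z with
  | Lq q _ _ => exact MemLp.sub hu hv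
  | C => exact ContinuousOn.sub hu hv
  | Reg => exact IsRegulatedOn.sub hτ hu hv

theorem MemOn.const_smul [NormedSpace ℂ U] (hu : Z.MemOn τ u) (k : ℂ) :
    Z.MemOn τ (fun s => k • u s) := by
  cases Z with
  | Lq q _ _ => exact MemLp.const_smul hu k
  | C => exact ContinuousOn.const_smul hu k
  | Reg => exact IsRegulatedOn.const_smul hu k

/-- ISS speaks of inputs on the half-line, admissibility of inputs on `[0,τ]`. Extension by zero
serves `L^q`; freezing the value at `τ` preserves continuity and regulatedness. -/
theorem MemOn.exists_extension (hτ : 0 < τ) (hu : Z.MemOn τ u) :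
    ∃ v, Z.MemLoc v ∧ EqOn v u (Icc 0 τ) := by
  have hmin : EqOn (fun s => u (min s τ)) u (Icc 0 τ) := fun s hs => by
    simp only [min_eq_left hs.2]
  cases Z with
  | Lq q _ _ =>
    refine ⟨(Icc 0 τ).indicator u, fun τ' _ => ?_, fun s hs => indicator_of_mem hs u⟩
    exact ((memLp_indicator_iff_restrict measurableSet_Icc).2 hu).restrict _
  | C =>
    refine ⟨_, fun τ' _ => ?_, hmin⟩
    refine ContinuousOn.comp hu (by fun_prop : Continuous fun s : ℝ => min s τ).continuousOn ?_
    exact fun s hs => ⟨le_min hs.1 hτ.le, min_le_right _ _⟩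
  | Reg => exact ⟨_, fun τ' hτ' => IsRegulatedOn.comp_min hτ.le hu hτ'.le, hmin⟩

theorem memOn_of_continuous (hZ : Z ≠ Reg) (hu : Continuous u) : Z.MemOn τ u := by
  have hC : C.MemOn τ u := hu.continuousOn
  cases Z with
  | Lq q _ _ => exact hC.memLp.mono_exponent le_top
  | C => exact hC
  | Reg => exact absurd rfl hZ

theorem normOn_nonneg : 0 ≤ Z.normOn t u := ENNReal.toReal_nonneg

theorem normOn_congr (h : EqOn u v (Icc 0 t)) : Z.normOn t u = Z.normOn t v := by
  unfold normOn
  rw [eLpNorm_congr_ae (ae_restrict_of_forall_mem measurableSet_Icc h)]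

theorem normOn_const_smul [NormedSpace ℂ U] (k : ℂ) :
    Z.normOn t (fun s => k • u s) = ‖k‖ * Z.normOn t u := by
  unfold normOn
  have := eLpNorm_const_smul k u Z.exponent (volume.restrict (Icc 0 t))
  rw [show (fun s => k • u s) = k • u from rfl, this, ENNReal.toReal_mul, toReal_enorm]

theorem MemOn.normOn_mono (hu : Z.MemOn τ u) (ht : t ≤ τ) : Z.normOn t u ≤ Z.normOn τ u :=
  ENNReal.toReal_mono hu.memLp.2.ne
    (eLpNorm_mono_measure u (Measure.restrict_mono (Icc_subset_Icc_right ht) le_rfl))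

/-- Hölder's inequality on a bounded interval. For exponent `∞` the conventions `∞.toReal = 0` and
`0⁻¹ = 0` make the factor `τ ^ 0 = 1`, so one formula covers all classes. -/
theorem normOn_le_of_ae_bound {B : ℝ} (hB : 0 ≤ B) (ht : 0 ≤ t) (htτ : t ≤ τ)
    (h : ∀ᵐ s ∂(volume.restrict (Icc 0 t)), ‖u s‖ ≤ B) :
    Z.normOn t u ≤ τ ^ Z.exponent.toReal⁻¹ * B := by
  have h1 := eLpNorm_le_of_ae_bound (p := Z.exponent) h
  rw [Measure.restrict_apply_univ, Real.volume_Icc, sub_zero,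
    ENNReal.ofReal_rpow_of_nonneg ht (by positivity), ← ENNReal.ofReal_mul (by positivity)] at h1
  refine (ENNReal.toReal_le_of_le_ofReal (by positivity) h1).trans ?_
  gcongr

theorem normOn_le_of_bound {B : ℝ} (hB : 0 ≤ B) (ht : 0 ≤ t) (htτ : t ≤ τ)
    (h : ∀ s ∈ Icc 0 t, ‖u s‖ ≤ B) : Z.normOn t u ≤ τ ^ Z.exponent.toReal⁻¹ * B :=
  normOn_le_of_ae_bound hB ht htτ (ae_restrict_of_forall_mem measurableSet_Icc h)

end InputClass

/-! ### Admissible control operators -/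

/-- Forward increments suffice because the modulus `δ` is uniform in the base point. -/
theorem continuousOn_Icc_of_shift {X : Type*} [NormedAddCommGroup X] {τ : ℝ} {z : ℝ → X}
    (h : ∀ ε > 0, ∃ δ > 0, ∀ h t, 0 ≤ h → h < δ → 0 ≤ t → t + h ≤ τ → ‖z (t + h) - z t‖ < ε) :
    ContinuousOn z (Icc 0 τ) := by
  rw [Metric.continuousOn_iff]
  intro b hb ε hε
  obtain ⟨δ, hδ, hz⟩ := h ε hε
  refine ⟨δ, hδ, fun a ha hab => ?_⟩
  rw [Real.dist_eq, abs_lt] at hab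
  rcases le_total a b with hle | hle
  · have := hz (b - a) a (by linarith) (by linarith) ha.1 (by linarith [hb.2])
    rwa [add_sub_cancel, ← dist_eq_norm, dist_comm] at this
  · have := hz (a - b) b (by linarith) (by linarith) hb.1 (by linarith [ha.2])
    rwa [add_sub_cancel, ← dist_eq_norm] at this

section Admissible

variable {X U : Type*} [NormedAddCommGroup X] [NormedSpace ℂ X]
  [NormedAddCommGroup U] [NormedSpace ℂ U]

/-- Infinite-time `𝒵`-admissibility with constant `σ`: every input in `𝒵` has an `X`-valued
trajectory, bounded by `σ` times the norm of the input. -/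
def IsAdmissible (Z : InputClass) (T : ℝ → X →L[ℂ] X) (R : X →L[ℂ] X) (G : U →L[ℂ] X)
    (σ : ℝ) : Prop :=
  ∀ τ, 0 < τ → ∀ u : ℝ → U, Z.MemOn τ u →
    ∃ z, IsTraj T R G τ u z ∧ ∀ t ∈ Icc 0 τ, ‖z t‖ ≤ σ * Z.normOn t u

variable {Z : InputClass} {T : ℝ → X →L[ℂ] X} {R : X →L[ℂ] X} {G : U →L[ℂ] X} {K σ τ : ℝ}
  {u v : ℝ → U} {z w : ℝ → X}

namespace IsAdmissible

theorem norm_le (hΦ : IsAdmissible Z T R G σ) (hR : Function.Injective R) (hτ : 0 < τ)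
    (hu : Z.MemOn τ u) (hz : IsTraj T R G τ u z) {t : ℝ} (ht : t ∈ Icc 0 τ) :
    ‖z t‖ ≤ σ * Z.normOn t u := by
  obtain ⟨w, hw, hb⟩ := hΦ τ hτ u hu
  rw [hz.eqOn hR hw ht]
  exact hb t ht

/-- Admissibility bounds the input-to-trajectory map from `𝒵` into the sup norm, so approximating
inputs in `𝒵` approximates trajectories uniformly. -/
theorem continuousOn_of_approx (hΦ : IsAdmissible Z T R G σ) (hT : IsC0Semigroup T)
    (hK : ∀ t, 0 ≤ t → ‖T t‖ ≤ K) (hR : Function.Injective R) (hσ : 0 ≤ σ) (hτ : 0 < τ)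
    (hu : Z.MemOn τ u) (hz : IsTraj T R G τ u z)
    (h : ∀ ε > 0, ∃ v w, Z.MemOn τ v ∧ IsTraj T R G τ v w ∧ ContinuousOn w (Icc 0 τ) ∧
      Z.normOn τ (fun s => u s - v s) ≤ ε) :
    ContinuousOn z (Icc 0 τ) := by
  refine continuousOn_of_uniform_approx_of_continuousOn fun V hV => ?_
  obtain ⟨ε, hε, hεV⟩ := Metric.mem_uniformity_dist.1 hV
  -- With `σ + 1` the denominator is positive even when `σ = 0`, and `σ / (2 * (σ + 1)) < 1`.
  obtain ⟨v, w, hv, hw, hwc, hd⟩ := h (ε / (2 * (σ + 1))) (by positivity)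
  refine ⟨w, hwc, fun t ht => hεV ?_⟩
  have huv := hu.sub hτ.le hv
  have h1 := hΦ.norm_le hR hτ huv (hz.sub hT hK hu.integrableOn hv.integrableOn hw) ht
  rw [dist_eq_norm]
  calc ‖z t - w t‖ ≤ σ * (ε / (2 * (σ + 1))) :=
        h1.trans (mul_le_mul_of_nonneg_left ((huv.normOn_mono ht.2).trans hd) hσ)
    _ = ε * (σ / (2 * (σ + 1))) := by ring
    _ < ε * 1 := by
        gcongr
        rw [div_lt_one (by positivity)]
        linarith
    _ = ε := mul_one _

/-- By the cocycle property `z (t + h) - z t = (w t - z t) + T t (z h)`, where `w` has input `u (· +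
h)`. The first term has the input `u (· + h) - u`, small by uniform continuity; the second is small
because `z` is continuous at `0`. -/
theorem continuousOn_of_continuous [CompleteSpace X] (hΦ : IsAdmissible Z T R G σ)
    (hT : IsC0Semigroup T)
    (hK : ∀ t, 0 ≤ t → ‖T t‖ ≤ K) (hR : Function.Injective R)
    (hRT : ∀ t, 0 ≤ t → ∀ y, R (T t y) = T t (R y))
    (hG : ∀ c : U, ∃ zc : ℝ → X, Continuous zc ∧ ∀ τ, IsTraj T R G τ (fun _ => c) zc)
    (hσ : 0 ≤ σ) (hZ : Z ≠ InputClass.Reg) (hτ : 0 < τ) (hu : Continuous u)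
    (hz : IsTraj T R G τ u z) : ContinuousOn z (Icc 0 τ) := by
  have hmem : ∀ {r : ℝ} {v : ℝ → U}, Continuous v → Z.MemOn r v := fun hv =>
    InputClass.memOn_of_continuous hZ hv
  have hint : ∀ {r : ℝ} {v : ℝ → U}, Continuous v → IntegrableOn v (Icc 0 r) := fun hv =>
    (hmem hv).integrableOn
  have hK0 : 0 ≤ K := (norm_nonneg _).trans (hK 0 le_rfl)
  set κ : ℝ := τ ^ Z.exponent.toReal⁻¹ with hκ
  have hκ0 : 0 ≤ κ := by positivity
  obtain ⟨zc, hzc, hzt⟩ := hG (u 0)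
  have hzc0 : zc 0 = 0 := (hzt 0).map_zero hR le_rfl
  refine continuousOn_Icc_of_shift fun ε hε => ?_
  set η : ℝ := ε / (4 * ((1 + K) * (σ * κ + 1))) with hη
  have hη0 : 0 < η := by positivity
  have hηε : (1 + K) * (σ * (κ * η)) ≤ ε / 4 := by
    have : (1 + K) * ((σ * κ + 1) * η) = ε / 4 := by
      rw [hη]; field_simp
    nlinarith [mul_nonneg (by positivity : 0 ≤ 1 + K) hη0.le]
  obtain ⟨δ₁, hδ₁, hδu⟩ := Metric.uniformContinuousOn_iff.1
    ((isCompact_Icc (a := (0 : ℝ)) (b := τ)).uniformContinuousOn_of_continuous hu.continuousOn)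
    η hη0
  obtain ⟨δ₂, hδ₂, hδz⟩ := Metric.continuous_iff.1 hzc 0 (ε / (4 * (1 + K))) (by positivity)
  refine ⟨min δ₁ δ₂, lt_min hδ₁ hδ₂, fun h t hh hhδ ht hth => ?_⟩
  have hh1 : h < δ₁ := hhδ.trans_le (min_le_left _ _)
  have hh2 : h < δ₂ := hhδ.trans_le (min_le_right _ _)
  have hhτ : h ≤ τ := by linarith
  -- Near time `0` the input is close to the constant `u 0`, whose trajectory `zc` is continuous and
  -- vanishes at `0`.
  have hzh : ‖z h‖ ≤ σ * (κ * η) + ε / (4 * (1 + K)) := by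
    have h1 := hΦ.norm_le hR hτ (hmem (by fun_prop : Continuous fun s => u s - u 0))
      (hz.sub hT hK (hint hu) (hint continuous_const) (hzt τ)) ⟨hh, hhτ⟩
    have h2 : Z.normOn h (fun s => u s - u 0) ≤ κ * η := by
      refine InputClass.normOn_le_of_bound hη0.le hh hhτ fun s hs => ?_
      rw [← dist_eq_norm]
      refine (hδu s ⟨hs.1, hs.2.trans hhτ⟩ 0 ⟨le_rfl, hτ.le⟩ ?_).le
      rw [Real.dist_eq, sub_zero, abs_of_nonneg hs.1]
      exact hs.2.trans_lt hh1
    have h3 := hδz h (by rwa [Real.dist_eq, sub_zero, abs_of_nonneg hh])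
    rw [hzc0, dist_zero_right] at h3
    calc ‖z h‖ = ‖(z h - zc h) + zc h‖ := by rw [sub_add_cancel]
      _ ≤ ‖z h - zc h‖ + ‖zc h‖ := norm_add_le _ _
      _ ≤ _ := add_le_add (h1.trans (mul_le_mul_of_nonneg_left h2 hσ)) h3.le
  -- Admissibility is only available on intervals of positive length, so `t = 0` is treated apart.
  rcases ht.eq_or_lt with rfl | ht0
  · rw [zero_add, hz.map_zero hR hτ.le, sub_zero]
    refine hzh.trans_lt ?_
    have h1 : σ * (κ * η) ≤ (1 + K) * (σ * (κ * η)) :=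
      le_mul_of_one_le_left (by positivity) (by linarith)
    have h2 : ε / (4 * (1 + K)) ≤ ε / 4 :=
      div_le_div_of_nonneg_left hε.le (by norm_num) (by linarith)
    linarith
  obtain ⟨w, hw, -⟩ := hΦ t ht0 (fun s => u (s + h)) (hmem (by fun_prop))
  have hwz : ‖w t - z t‖ ≤ σ * (κ * η) := by
    have h1 := hΦ.norm_le hR ht0 (hmem (by fun_prop : Continuous fun s => u (s + h) - u s))
      (hw.sub hT hK (hint (by fun_prop)) (hint hu) (hz.mono (by linarith))) ⟨ht0.le, le_rfl⟩
    refine h1.trans (mul_le_mul_of_nonneg_left ?_ hσ)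
    refine InputClass.normOn_le_of_bound hη0.le ht (by linarith) fun s hs => ?_
    rw [← dist_eq_norm]
    refine (hδu _ ⟨by linarith [hs.1], by linarith [hs.2]⟩ s ⟨hs.1, by linarith [hs.2]⟩ ?_).le
    rwa [Real.dist_eq, add_sub_cancel_left, abs_of_nonneg hh]
  rw [hz.shift hT hK hR hRT (hint hu) hh ht hth hw]
  have hTz : ‖T t (z h)‖ ≤ K * (σ * (κ * η) + ε / (4 * (1 + K))) :=
    ((T t).le_of_opNorm_le (hK t ht) _).trans (mul_le_mul_of_nonneg_left hzh hK0)
  have h2 : K * (ε / (4 * (1 + K))) ≤ ε / 4 := by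
    rw [mul_div_assoc', div_le_div_iff₀ (by positivity) (by norm_num)]
    nlinarith
  calc ‖w t + T t (z h) - z t‖ = ‖(w t - z t) + T t (z h)‖ := by congr 1; abel
    _ ≤ σ * (κ * η) + K * (σ * (κ * η) + ε / (4 * (1 + K))) :=
        (norm_add_le _ _).trans (add_le_add hwz hTz)
    _ = (1 + K) * (σ * (κ * η)) + K * (ε / (4 * (1 + K))) := by ring
    _ < ε := by linarith

end IsAdmissible

/-- Trajectories for step functions are continuous. -/
theorem IsStepOn.exists_continuous_isTraj (hT : IsC0Semigroup T)
    (hK : ∀ t, 0 ≤ t → ‖T t‖ ≤ K) (hR : Function.Injective R)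
    (hG : ∀ c : U, ∃ zc : ℝ → X, Continuous zc ∧ ∀ τ, IsTraj T R G τ (fun _ => c) zc)
    (hu : IsStepOn τ u) : ∃ z, IsTraj T R G τ u z ∧ Continuous z := by
  obtain ⟨n, a, c, ha, huc⟩ := hu.exists_sum_heaviside
  have hH : ∀ (b : ℝ) (d : U), IntegrableOn ((Ioi b).indicator fun _ => d) (Icc 0 τ) := fun b d =>
    (integrable_const d).indicator measurableSet_Ioi
  -- Integrability is carried through the induction because additivity of trajectories requires it.
  have key : ∀ n : ℕ,
      IntegrableOn (fun s => ∑ i ∈ Finset.range n, ((Ioi (a i)).indicator (fun _ => c i) s -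
        (Ioi (a (i + 1))).indicator (fun _ => c i) s)) (Icc 0 τ) ∧
      ∃ z, IsTraj T R G τ (fun s => ∑ i ∈ Finset.range n, ((Ioi (a i)).indicator (fun _ => c i) s -
        (Ioi (a (i + 1))).indicator (fun _ => c i) s)) z ∧ Continuous z := by
    intro n
    induction n with
    | zero =>
      refine ⟨by simp, fun _ => 0, fun t _ => by simp, continuous_const⟩
    | succ n ih =>
      obtain ⟨hi, z, hz, hzc⟩ := ih
      obtain ⟨zc, hzcc, hzt⟩ := hG (c n)
      simp only [Finset.sum_range_succ]
      have hi' := (hH (a n) (c n)).sub (hH (a (n + 1)) (c n))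
      exact ⟨hi.add hi', _, hz.add hT hK hi hi' (IsTraj.sub hT hK (hH _ _) (hH _ _)
        (IsTraj.heaviside (ha n) hR hzt) (IsTraj.heaviside (ha (n + 1)) hR hzt)), by fun_prop⟩
  obtain ⟨-, z, hz, hzc⟩ := key n
  exact ⟨z, hz.congr_ae (by filter_upwards [huc] with s hs using hs.symm), hzc⟩

/-- Trajectories for admissible control operators are continuous. -/
theorem IsAdmissible.continuousOn [CompleteSpace X] (hΦ : IsAdmissible Z T R G σ)
    (hT : IsC0Semigroup T)
    (hK : ∀ t, 0 ≤ t → ‖T t‖ ≤ K) (hR : Function.Injective R)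
    (hRT : ∀ t, 0 ≤ t → ∀ y, R (T t y) = T t (R y))
    (hG : ∀ c : U, ∃ zc : ℝ → X, Continuous zc ∧ ∀ τ, IsTraj T R G τ (fun _ => c) zc)
    (hσ : 0 ≤ σ) (hτ : 0 < τ) (hu : Z.MemOn τ u) (hz : IsTraj T R G τ u z) :
    ContinuousOn z (Icc 0 τ) := by
  cases Z with
  | Lq q h1 h2 =>
    -- Bounded continuous functions are dense in `L^q` for `q < ∞`.
    refine hΦ.continuousOn_of_approx hT hK hR hσ hτ hu hz fun ε hε => ?_
    obtain ⟨g, hg, -⟩ := MemLp.exists_boundedContinuous_eLpNorm_sub_le h2 hu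
      (ENNReal.ofReal_pos.2 hε).ne'
    have hgm := InputClass.memOn_of_continuous (Z := .Lq q h1 h2) (τ := τ)
      (fun h => nomatch h) g.continuous
    obtain ⟨w, hw, -⟩ := hΦ τ hτ g hgm
    exact ⟨g, w, hgm, hw, hΦ.continuousOn_of_continuous hT hK hR hRT hG hσ (fun h => nomatch h) hτ
      g.continuous hw, ENNReal.toReal_le_of_le_ofReal hε.le hg⟩
  | C =>
    -- Constant continuation outside `[0,τ]` gives a globally continuous input with the same
    -- trajectory.
    have hc : Continuous (IccExtend hτ.le ((Icc 0 τ).domRestrict u)) :=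
      (continuousOn_iff_continuous_domRestrict.1 hu).Icc_extend'
    refine hΦ.continuousOn_of_continuous hT hK hR hRT hG hσ (fun h => nomatch h) hτ hc
      (hz.congr fun s hs => ?_)
    rw [IccExtend_of_mem _ _ hs, domRestrict_apply]
  | Reg =>
    -- Translation is not continuous in the sup norm at a jump, so step functions, handled through
    -- Heaviside inputs, replace continuous ones.
    refine hΦ.continuousOn_of_approx hT hK hR hσ hτ hu hz fun ε hε => ?_
    obtain ⟨g, hg, hug⟩ := hu ε hε
    obtain ⟨w, hw, hwc⟩ := hg.exists_continuous_isTraj hT hK hR hG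
    refine ⟨g, w, hg.isRegulatedOn, hw, hwc.continuousOn, ?_⟩
    refine (InputClass.normOn_le_of_bound hε.le hτ.le le_rfl hug).trans (le_of_eq ?_)
    simp [InputClass.exponent]

end Admissible

/-! ### Translation of inputs, and bounds uniform in time -/

namespace InputClass

variable {U : Type*} [NormedAddCommGroup U] {Z : InputClass} {τ : ℝ} {u : ℝ → U}

theorem nonneg_of_ae_bound {B : ℝ} (hτ : 0 < τ)
    (h : ∀ᵐ s ∂(volume.restrict (Icc 0 τ)), ‖u s‖ ≤ B) : 0 ≤ B := by
  have : (ae (volume.restrict (Icc (0 : ℝ) τ))).NeBot := by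
    rw [ae_neBot, Ne, Measure.restrict_eq_zero, Real.volume_Icc, sub_zero]
    exact (ENNReal.ofReal_pos.2 hτ).ne'
  obtain ⟨s, hs⟩ := h.exists
  exact (norm_nonneg _).trans hs

theorem measurePreserving_add_Icc (h r : ℝ) :
    MeasurePreserving (fun s : ℝ => s + h) (volume.restrict (Icc 0 r))
      (volume.restrict (Icc h (r + h))) := by
  have := (measurePreserving_add_right (volume : Measure ℝ) h).restrict_preimage
    (measurableSet_Icc (a := h) (b := r + h))
  simpa using this

theorem memOn_shift {q : ℝ≥0∞} {h1 : 1 ≤ q} {h2 : q ≠ ∞} (hu : (Lq q h1 h2).MemOn τ u) {h r : ℝ}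
    (hh : 0 ≤ h) (hr : r + h ≤ τ) : (Lq q h1 h2).MemOn r fun s => u (s + h) :=
  MemLp.comp_measurePreserving
    (MemLp.mono_measure (Measure.restrict_mono (Icc_subset_Icc hh hr) le_rfl) hu)
    (measurePreserving_add_Icc h r)

theorem ae_bound_shift {B : ℝ} (hB : ∀ᵐ s ∂(volume.restrict (Icc 0 τ)), ‖u s‖ ≤ B) {h r : ℝ}
    (hh : 0 ≤ h) (hr : r + h ≤ τ) : ∀ᵐ s ∂(volume.restrict (Icc 0 r)), ‖u (s + h)‖ ≤ B :=
  (measurePreserving_add_Icc h r).quasiMeasurePreserving.ae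
    (ae_mono (Measure.restrict_mono (Icc_subset_Icc hh hr) le_rfl) hB)

end InputClass

/-- Admissibility of an exponentially stable system yields an infinite-time bound in terms of the
essential supremum of the input. -/
theorem IsAdmissible.exists_norm_le_of_ae_bound {X U : Type*} [NormedAddCommGroup X]
    [NormedSpace ℂ X] [CompleteSpace X] [NormedAddCommGroup U] [NormedSpace ℂ U]
    {Z : InputClass} {T : ℝ → X →L[ℂ] X} {R : X →L[ℂ] X} {G : U →L[ℂ] X} {σ M ω : ℝ}
    (hΦ : IsAdmissible Z T R G σ)
    (hT : IsC0Semigroup T) (hω : ω < 0)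
    (hM : ∀ t, 0 ≤ t → ‖T t‖ ≤ M * Real.exp (ω * t)) (hR : Function.Injective R)
    (hRT : ∀ t, 0 ≤ t → ∀ y, R (T t y) = T t (R y)) (hσ : 0 ≤ σ) :
    ∃ σ' : ℝ, 0 ≤ σ' ∧ ∀ (τ : ℝ) (u : ℝ → U) (z : ℝ → X) (B : ℝ), 0 < τ → Z.MemOn τ u →
      IsTraj T R G τ u z → (∀ᵐ s ∂(volume.restrict (Icc 0 τ)), ‖u s‖ ≤ B) →
      ∀ t ∈ Icc 0 τ, ‖z t‖ ≤ σ' * B := by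
  have hK : ∀ t, 0 ≤ t → ‖T t‖ ≤ M := fun t ht => IsC0Semigroup.norm_le_of_exp hM hω ht
  -- For `C` and `Reg` the norm is already the essential supremum. For `L^q` Hölder's inequality
  -- alone would give a bound growing like `t ^ (1 / q)`.
  have hsup : Z.exponent = ∞ →
      ∃ σ' : ℝ, 0 ≤ σ' ∧ ∀ (τ : ℝ) (u : ℝ → U) (z : ℝ → X) (B : ℝ), 0 < τ → Z.MemOn τ u →
      IsTraj T R G τ u z → (∀ᵐ s ∂(volume.restrict (Icc 0 τ)), ‖u s‖ ≤ B) →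
      ∀ t ∈ Icc 0 τ, ‖z t‖ ≤ σ' * B := by
    refine fun hZ => ⟨σ, hσ, fun τ u z B hτ hu hz hB t ht => ?_⟩
    have hB0 := InputClass.nonneg_of_ae_bound hτ hB
    refine (hΦ.norm_le hR hτ hu hz ht).trans (mul_le_mul_of_nonneg_left ?_ hσ)
    have := InputClass.normOn_le_of_ae_bound (Z := Z) hB0 ht.1 ht.2
      (ae_mono (Measure.restrict_mono (Icc_subset_Icc_right ht.2) le_rfl) hB)
    simpa [hZ] using this
  cases Z with
  | C => exact hsup rfl
  | Reg => exact hsup rfl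
  | Lq q h1 h2 =>
    -- Over a time step `r` the semigroup halves the norm, which makes the contributions of earlier
    -- steps summable.
    obtain ⟨r, hr0, hr⟩ : ∃ r : ℝ, 0 < r ∧ M * Real.exp (ω * r) ≤ 1 / 2 := by
      have h1 : Tendsto (fun r : ℝ => M * Real.exp (ω * r)) atTop (𝓝 (M * 0)) :=
        (Real.tendsto_exp_atBot.comp (tendsto_id.const_mul_atTop_of_neg hω)).const_mul M
      rw [mul_zero] at h1
      obtain ⟨r, hr, hr'⟩ := ((eventually_gt_atTop (0 : ℝ)).and
        (h1.eventually_le_const (by norm_num : (0 : ℝ) < 1 / 2))).exists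
      exact ⟨r, hr, hr'⟩
    set κ : ℝ := r ^ (InputClass.Lq q h1 h2).exponent.toReal⁻¹ with hκ
    have hκ0 : 0 ≤ κ := by positivity
    -- The constant solves `C = σ κ + C / 2`: one step of input plus half of the bound one step
    -- earlier, by `z t = w r + T r (z (t - r))`.
    refine ⟨2 * (σ * κ), by positivity, fun τ u z B hτ hu hz hB => ?_⟩
    have hB0 := InputClass.nonneg_of_ae_bound hτ hB
    have key : ∀ n : ℕ, ∀ t ∈ Icc 0 τ, t ≤ n * r → ‖z t‖ ≤ 2 * (σ * κ) * B := by
      intro n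
      induction n with
      | zero =>
        intro t ht htn
        have : t = 0 := le_antisymm (by simpa using htn) ht.1
        rw [this, hz.map_zero hR hτ.le, norm_zero]
        positivity
      | succ n ih =>
        intro t ht htn
        rcases le_total t r with htr | htr
        · refine (hΦ.norm_le hR hτ hu hz ht).trans ?_
          have h3 := InputClass.normOn_le_of_ae_bound (Z := .Lq q h1 h2) hB0 ht.1 htr
            (ae_mono (Measure.restrict_mono (Icc_subset_Icc_right ht.2) le_rfl) hB)
          have h4 := mul_le_mul_of_nonneg_left h3 hσ
          have h5 : 0 ≤ σ * κ * B := by positivity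
          rw [← hκ] at h4
          linarith
        · have hh : 0 ≤ t - r := by linarith
          have hs := InputClass.memOn_shift hu (h := t - r) (r := r) hh (by linarith [ht.2])
          obtain ⟨w, hw, -⟩ := hΦ r hr0 _ hs
          have h3 := hz.shift hT hK hR hRT hu.integrableOn hh hr0.le (by linarith [ht.2]) hw
          rw [add_sub_cancel] at h3
          have h4 := hΦ.norm_le hR hr0 hs hw ⟨hr0.le, le_rfl⟩
          have h5 := mul_le_mul_of_nonneg_left (InputClass.normOn_le_of_ae_bound
            (Z := .Lq q h1 h2) hB0 hr0.le le_rfl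
            (InputClass.ae_bound_shift hB hh (by linarith [ht.2]))) hσ
          rw [← hκ] at h5
          have h6 := ih (t - r) ⟨hh, by linarith [ht.2]⟩ (by push_cast at htn; linarith)
          have h7 : ‖T r (z (t - r))‖ ≤ 1 / 2 * (2 * (σ * κ) * B) :=
            ((T r).le_of_opNorm_le ((hM r hr0.le).trans hr) _).trans
              (mul_le_mul_of_nonneg_left h6 (by norm_num))
          rw [h3]
          refine (norm_add_le _ _).trans ?_
          linarith
    intro t ht
    obtain ⟨n, hn⟩ := exists_nat_ge (t / r)
    exact key n t ht ((div_le_iff₀ hr0).1 hn)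

/-! ### A comparison principle for Volterra inequalities with exponential kernel -/

/-- Up to boundary terms decaying like `exp (ω t)`, the Volterra operator fixes `exp ((ω + k) s)`
and multiplies constants by `k / -ω`. These are the two ingredients of the comparison function. -/
theorem integral_mul_exp_conv {ω k : ℝ} (hω : ω ≠ 0) (a c t : ℝ) :
    ∫ s in (0 : ℝ)..t, k * Real.exp (ω * (t - s)) * (a * Real.exp ((ω + k) * s) + c) =
      a * (Real.exp ((ω + k) * t) - Real.exp (ω * t)) + k * c * ((1 - Real.exp (ω * t)) / -ω) := by
  have hd : ∀ s, HasDerivAt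
      (fun s => a * (Real.exp (ω * (t - s)) * Real.exp ((ω + k) * s)) +
        k * c * (Real.exp (ω * (t - s)) / -ω))
      (k * Real.exp (ω * (t - s)) * (a * Real.exp ((ω + k) * s) + c)) s := by
    intro s
    have h1 : HasDerivAt (fun s => Real.exp (ω * (t - s))) (Real.exp (ω * (t - s)) * (ω * -1)) s :=
      (((hasDerivAt_id s).const_sub t).const_mul ω).exp
    have h2 : HasDerivAt (fun s => Real.exp ((ω + k) * s))
        (Real.exp ((ω + k) * s) * ((ω + k) * 1)) s :=
      ((hasDerivAt_id s).const_mul (ω + k)).exp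
    refine (((h1.mul h2).const_mul a).add
      ((h1.div_const (-ω)).const_mul (k * c))).congr_deriv ?_
    field_simp
    ring
  rw [intervalIntegral.integral_eq_sub_of_hasDerivAt (fun s _ => hd s)
    (Continuous.intervalIntegrable (by fun_prop) _ _)]
  simp only [sub_self, mul_zero, Real.exp_zero, sub_zero]
  field_simp
  ring

/-- At a positive maximum `d m` the right-hand side is at most `k / -ω * d m`, which is less than `d
m` since `k < -ω`. -/
theorem nonpos_of_le_integral_exp {ω k τ : ℝ} {d : ℝ → ℝ} (hω : ω < 0) (hk : 0 ≤ k)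
    (hωk : ω + k < 0) (hd : ContinuousOn d (Icc 0 τ))
    (h : ∀ t ∈ Icc 0 τ, d t ≤ ∫ s in (0 : ℝ)..t, k * Real.exp (ω * (t - s)) * d s) :
    ∀ t ∈ Icc 0 τ, d t ≤ 0 := by
  intro t ht
  obtain ⟨m, hm, hmax⟩ := isCompact_Icc.exists_isMaxOn ⟨t, ht⟩ hd
  refine (hmax ht).trans (not_lt.1 fun hpos => ?_)
  -- The zero coefficient puts the constant `d m` in the form of `integral_mul_exp_conv`.
  have h1 : ∫ s in (0 : ℝ)..m, k * Real.exp (ω * (m - s)) * d s ≤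
      ∫ s in (0 : ℝ)..m, k * Real.exp (ω * (m - s)) * (0 * Real.exp ((ω + k) * s) + d m) := by
    refine intervalIntegral.integral_mono_on hm.1 ?_
      (Continuous.intervalIntegrable (by fun_prop) _ _) fun s hs => ?_
    · refine ContinuousOn.intervalIntegrable ?_
      rw [uIcc_of_le hm.1]
      exact (Continuous.continuousOn (by fun_prop)).mul (hd.mono (Icc_subset_Icc_right hm.2))
    · rw [zero_mul, zero_add]
      exact mul_le_mul_of_nonneg_left (hmax ⟨hs.1, hs.2.trans hm.2⟩) (by positivity)
  rw [integral_mul_exp_conv hω.ne, zero_mul, zero_add] at h1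
  have h2 := (h m hm).trans h1
  have h3 : (1 - Real.exp (ω * m)) / -ω ≤ 1 / -ω :=
    div_le_div_of_nonneg_right (by linarith [Real.exp_pos (ω * m)]) (by linarith)
  have h4 : k * d m * (1 / -ω) < d m := by
    rw [mul_one_div, div_lt_iff₀ (by linarith)]
    nlinarith
  exact absurd (h2.trans (mul_le_mul_of_nonneg_left h3 (by positivity))) (not_le.2 h4)

/-- The claimed bound is a supersolution of the integral inequality, and its difference from `n` is
subject to `nonpos_of_le_integral_exp`. The constant `c' = ω / (ω + k) * c` is the solution of `c' =
c + k / -ω * c'`. -/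
theorem le_exp_of_le_integral_exp {ω k τ a c : ℝ} {n : ℝ → ℝ} (hω : ω < 0) (hk : 0 ≤ k)
    (hωk : ω + k < 0) (hc : 0 ≤ c) (hn : ContinuousOn n (Icc 0 τ))
    (h : ∀ t ∈ Icc 0 τ, n t ≤ a * Real.exp (ω * t) + c +
      ∫ s in (0 : ℝ)..t, k * Real.exp (ω * (t - s)) * n s) :
    ∀ t ∈ Icc 0 τ, n t ≤ a * Real.exp ((ω + k) * t) + ω / (ω + k) * c := by
  set c' : ℝ := ω / (ω + k) * c with hc'
  have hc'0 : 0 ≤ c' := mul_nonneg (div_nonneg_of_nonpos hω.le hωk.le) hc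
  have hcc : (ω + k) * c' = ω * c := by
    rw [hc', ← mul_assoc, mul_div_cancel₀ _ hωk.ne]
  have hp : Continuous fun s => a * Real.exp ((ω + k) * s) + c' := by fun_prop
  suffices H : ∀ t ∈ Icc 0 τ, n t - (a * Real.exp ((ω + k) * t) + c') ≤ 0 from
    fun t ht => sub_nonpos.1 (H t ht)
  refine nonpos_of_le_integral_exp hω hk hωk (hn.sub hp.continuousOn) fun t ht => ?_
  have hi : IntervalIntegrable (fun s => k * Real.exp (ω * (t - s)) * n s) volume 0 t := by
    refine ContinuousOn.intervalIntegrable ?_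
    rw [uIcc_of_le ht.1]
    exact (Continuous.continuousOn (by fun_prop)).mul (hn.mono (Icc_subset_Icc_right ht.2))
  have hi' : IntervalIntegrable
      (fun s => k * Real.exp (ω * (t - s)) * (a * Real.exp ((ω + k) * s) + c')) volume 0 t :=
    Continuous.intervalIntegrable (by fun_prop) _ _
  have e : ∫ s in (0 : ℝ)..t, k * Real.exp (ω * (t - s)) *
      (n s - (a * Real.exp ((ω + k) * s) + c')) =
      (∫ s in (0 : ℝ)..t, k * Real.exp (ω * (t - s)) * n s) -
      ∫ s in (0 : ℝ)..t, k * Real.exp (ω * (t - s)) * (a * Real.exp ((ω + k) * s) + c') := by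
    rw [← intervalIntegral.integral_sub hi hi']
    simp only [mul_sub]
  rw [e, integral_mul_exp_conv hω.ne]
  have h1 := h t ht
  have h2 : k * c' * ((1 - Real.exp (ω * t)) / -ω) ≤ c' - c := by
    rw [mul_div_assoc', div_le_iff₀ (by linarith)]
    nlinarith [mul_nonneg (mul_nonneg hk hc'0) (Real.exp_pos (ω * t)).le]
  linarith

/-! ### Lipschitz perturbations of the variation of constants formula -/

section Perturbation

variable {X : Type*} [NormedAddCommGroup X] {f : ℝ → X → X} {L : ℝ}

theorem continuous_max_of_lipschitz (hf : ∀ x, ContinuousOn (fun t => f t x) (Ici 0))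
    (hL : ∀ t, 0 ≤ t → ∀ x y, ‖f t x - f t y‖ ≤ L * ‖x - y‖) :
    Continuous fun p : ℝ × X => f (max p.1 0) p.2 := by
  refine (continuous_prod_of_continuous_lipschitzWith
    (fun p : X × ℝ => f (max p.2 0) p.1) L.toNNReal ?_ ?_).comp continuous_swap
  · intro x
    exact (hf x).comp_continuous (by fun_prop) fun s => mem_Ici.2 (le_max_right _ _)
  · intro t
    refine LipschitzWith.of_dist_le_mul fun x y => ?_
    rw [dist_eq_norm, dist_eq_norm]
    exact (hL _ (le_max_right _ _) x y).trans
      (mul_le_mul_of_nonneg_right (Real.le_coe_toNNReal L) (norm_nonneg _))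

theorem continuousOn_comp_of_lipschitz (hf : ∀ x, ContinuousOn (fun t => f t x) (Ici 0))
    (hL : ∀ t, 0 ≤ t → ∀ x y, ‖f t x - f t y‖ ≤ L * ‖x - y‖) {τ : ℝ} {x : ℝ → X}
    (hx : ContinuousOn x (Icc 0 τ)) : ContinuousOn (fun s => f s (x s)) (Icc 0 τ) := by
  refine ((continuous_max_of_lipschitz hf hL).comp_continuousOn
    (continuousOn_id.prodMk hx)).congr fun s hs => ?_
  simp only [Function.comp_apply, id, max_eq_left hs.1]

variable [NormedSpace ℂ X] {T : ℝ → X →L[ℂ] X} {M ω τ : ℝ} {h x y : ℝ → X}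

/-- The majorant `n` is left free: it is `‖x‖` for the growth bound, `‖x - y‖` for uniqueness and a
constant for the contraction. -/
theorem norm_conv_le (hM : ∀ t, 0 ≤ t → ‖T t‖ ≤ M * Real.exp (ω * t)) {g : ℝ → X} {n : ℝ → ℝ}
    {t : ℝ} (ht : 0 ≤ t) (hn : ContinuousOn n (Icc 0 t))
    (hg : ∀ s ∈ Icc 0 t, ‖g s‖ ≤ L * n s) :
    ‖∫ s in (0 : ℝ)..t, T (t - s) (g s)‖ ≤
      ∫ s in (0 : ℝ)..t, M * L * Real.exp (ω * (t - s)) * n s := by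
  refine intervalIntegral.norm_integral_le_of_norm_le ht (Eventually.of_forall fun s hs => ?_) ?_
  · calc ‖T (t - s) (g s)‖ ≤ M * Real.exp (ω * (t - s)) * (L * n s) :=
        (T (t - s)).le_of_opNorm_le_of_le (hM _ (by linarith [hs.2])) (hg s ⟨hs.1.le, hs.2⟩)
      _ = _ := by ring
  · refine ContinuousOn.intervalIntegrable ?_
    rw [uIcc_of_le ht]
    exact (Continuous.continuousOn (by fun_prop)).mul hn

theorem norm_le_of_lipschitz (hM : ∀ t, 0 ≤ t → ‖T t‖ ≤ M * Real.exp (ω * t))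
    (hL : ∀ t, 0 ≤ t → ∀ x y, ‖f t x - f t y‖ ≤ L * ‖x - y‖) (hL0 : 0 ≤ L)
    (hf0 : ∀ t, 0 ≤ t → f t 0 = 0) (hω : ω < 0)
    (hωL : ω + M * L < 0) {a c : ℝ} (hc : 0 ≤ c) (hxc : ContinuousOn x (Icc 0 τ))
    (hx : ∀ t ∈ Icc 0 τ, x t = h t + ∫ s in (0 : ℝ)..t, T (t - s) (f s (x s)))
    (hh : ∀ t ∈ Icc 0 τ, ‖h t‖ ≤ a * Real.exp (ω * t) + c) :
    ∀ t ∈ Icc 0 τ, ‖x t‖ ≤ a * Real.exp ((ω + M * L) * t) + ω / (ω + M * L) * c := by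
  have hM0 : 0 ≤ M := (norm_nonneg _).trans (IsC0Semigroup.norm_le_of_exp hM hω le_rfl)
  refine le_exp_of_le_integral_exp hω (mul_nonneg hM0 hL0) hωL hc hxc.norm fun t ht => ?_
  rw [hx t ht]
  refine (norm_add_le _ _).trans (add_le_add (hh t ht) ?_)
  refine norm_conv_le hM ht.1 (hxc.norm.mono (Icc_subset_Icc_right ht.2)) fun s hs => ?_
  simpa [hf0 s hs.1] using hL s hs.1 (x s) 0

theorem eqOn_of_lipschitz (hT : IsC0Semigroup T)
    (hM : ∀ t, 0 ≤ t → ‖T t‖ ≤ M * Real.exp (ω * t))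
    (hf : ∀ x, ContinuousOn (fun t => f t x) (Ici 0))
    (hL : ∀ t, 0 ≤ t → ∀ x y, ‖f t x - f t y‖ ≤ L * ‖x - y‖) (hL0 : 0 ≤ L) (hω : ω < 0)
    (hωL : ω + M * L < 0) (hxc : ContinuousOn x (Icc 0 τ)) (hyc : ContinuousOn y (Icc 0 τ))
    (hx : ∀ t ∈ Icc 0 τ, x t = h t + ∫ s in (0 : ℝ)..t, T (t - s) (f s (x s)))
    (hy : ∀ t ∈ Icc 0 τ, y t = h t + ∫ s in (0 : ℝ)..t, T (t - s) (f s (y s))) :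
    EqOn x y (Icc 0 τ) := by
  have hK : ∀ t, 0 ≤ t → ‖T t‖ ≤ M := fun t ht => IsC0Semigroup.norm_le_of_exp hM hω ht
  have hM0 : 0 ≤ M := (norm_nonneg _).trans (hK 0 le_rfl)
  have hi : ∀ {z : ℝ → X} {t : ℝ}, t ∈ Icc 0 τ → ContinuousOn z (Icc 0 τ) →
      IntervalIntegrable (fun s => T (t - s) (f s (z s))) volume 0 t := fun {z t} ht hz =>
    hT.intervalIntegrable_conv hK ht.1 le_rfl
      (((continuousOn_comp_of_lipschitz hf hL hz).mono
        (Icc_subset_Icc_right ht.2)).integrableOn_Icc)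
  suffices hn : ∀ t ∈ Icc 0 τ, ‖x t - y t‖ ≤ 0 from
    fun t ht => sub_eq_zero.1 (norm_le_zero_iff.1 (hn t ht))
  refine nonpos_of_le_integral_exp hω (mul_nonneg hM0 hL0) hωL (hxc.sub hyc).norm fun t ht => ?_
  rw [hx t ht, hy t ht, add_sub_add_left_eq_sub,
    ← intervalIntegral.integral_sub (hi ht hxc) (hi ht hyc)]
  simp only [← map_sub]
  exact norm_conv_le hM ht.1 ((hxc.sub hyc).norm.mono (Icc_subset_Icc_right ht.2))
    fun s hs => hL s hs.1 _ _

variable [CompleteSpace X]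

/-- Banach's fixed point theorem in the sup norm. The Lipschitz constant `M L / -ω < 1` is
independent of `τ`, so neither short time steps nor a weighted norm are needed. -/
theorem exists_solution_of_lipschitz (hT : IsC0Semigroup T)
    (hM : ∀ t, 0 ≤ t → ‖T t‖ ≤ M * Real.exp (ω * t))
    (hf : ∀ x, ContinuousOn (fun t => f t x) (Ici 0))
    (hL : ∀ t, 0 ≤ t → ∀ x y, ‖f t x - f t y‖ ≤ L * ‖x - y‖) (hL0 : 0 ≤ L) (hω : ω < 0)
    (hωL : ω + M * L < 0) (hτ : 0 ≤ τ) (hh : ContinuousOn h (Icc 0 τ)) :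
    ∃ x : ℝ → X, ContinuousOn x (Icc 0 τ) ∧
      ∀ t ∈ Icc 0 τ, x t = h t + ∫ s in (0 : ℝ)..t, T (t - s) (f s (x s)) := by
  have hK : ∀ t, 0 ≤ t → ‖T t‖ ≤ M := fun t ht => IsC0Semigroup.norm_le_of_exp hM hω ht
  have hM0 : 0 ≤ M := (norm_nonneg _).trans (hK 0 le_rfl)
  have hfm := continuous_max_of_lipschitz hf hL
  have hgc : ∀ y : C(Icc 0 τ, X), Continuous fun s => f (max s 0) (IccExtend hτ y s) := fun y =>
    hfm.comp (continuous_id.prodMk y.continuous.Icc_extend')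
  -- The clamps and `IccExtend` make the integrand globally continuous; on `[0,t]` they change
  -- nothing.
  let F : C(Icc 0 τ, X) → C(Icc 0 τ, X) := fun y =>
    ⟨fun t => h t + ∫ s in (0 : ℝ)..t, T (max (t - s) 0) (f (max s 0) (IccExtend hτ y s)),
      (continuousOn_iff_continuous_domRestrict.1 hh).add
        ((hT.continuous_conv hK (hgc y)).comp continuous_subtype_val)⟩
  have hFapp : ∀ y (t : Icc (0 : ℝ) τ), F y t =
      h t + ∫ s in (0 : ℝ)..t, T (t - s) (f (max s 0) (IccExtend hτ y s)) := fun y t => by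
    rw [IsC0Semigroup.conv_eq_max t.2.1]
    rfl
  have hML : 0 ≤ M * L := mul_nonneg hM0 hL0
  have hq0 : 0 ≤ M * L / -ω := div_nonneg hML (by linarith)
  have hF : ContractingWith (M * L / -ω).toNNReal F := by
    refine ⟨?_, LipschitzWith.of_dist_le_mul fun y y' => ?_⟩
    · rw [← NNReal.coe_lt_coe, Real.coe_toNNReal _ hq0, NNReal.coe_one, div_lt_one (by linarith)]
      linarith
    · rw [Real.coe_toNNReal _ hq0, ContinuousMap.dist_le (by positivity)]
      intro t
      rw [dist_eq_norm, hFapp, hFapp, add_sub_add_left_eq_sub,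
        ← intervalIntegral.integral_sub
          (hT.intervalIntegrable_conv hK t.2.1 le_rfl (hgc y).integrableOn_Icc)
          (hT.intervalIntegrable_conv hK t.2.1 le_rfl (hgc y').integrableOn_Icc)]
      simp only [← map_sub]
      refine (norm_conv_le (L := L) (n := fun s => 0 * Real.exp ((ω + M * L) * s) + dist y y') hM
        t.2.1 (Continuous.continuousOn (by fun_prop)) fun s hs => ?_).trans ?_
      · refine (hL _ (le_max_right _ _) _ _).trans (mul_le_mul_of_nonneg_left ?_ hL0)
        rw [zero_mul, zero_add, ← dist_eq_norm]
        exact ContinuousMap.dist_apply_le_dist _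
      · rw [integral_mul_exp_conv hω.ne, zero_mul, zero_add, mul_div_assoc', div_mul_eq_mul_div]
        refine div_le_div_of_nonneg_right ?_ (by linarith)
        refine mul_le_of_le_one_right (by positivity) ?_
        linarith [Real.exp_pos (ω * t)]
  have hfix := hF.fixedPoint_isFixedPt
  set y := ContractingWith.fixedPoint F hF
  refine ⟨IccExtend hτ y, y.continuous.Icc_extend'.continuousOn, fun t ht => ?_⟩
  have h1 := hFapp y ⟨t, ht⟩
  rw [hfix] at h1
  rw [IccExtend_of_mem _ _ ht, h1]
  congr 1
  refine intervalIntegral.integral_congr fun s hs => ?_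
  rw [uIcc_of_le ht.1] at hs
  simp only [max_eq_left hs.1]

end Perturbation

/-! ### Boundary control systems in terms of the resolvent -/

namespace BoundaryControlSystem

variable {X U : Type*} [NormedAddCommGroup X] [NormedSpace ℂ X] [CompleteSpace X]
  [NormedAddCommGroup U] [NormedSpace ℂ U]
  (S : BoundaryControlSystem X U) (ρ : S.ResolventPoint)

/-- The control operator composed with the extended resolvent, `(lam - A₋₁)⁻¹ B : U → X`. -/
noncomputable def RB : U →L[ℂ] X :=
  ρ.R.comp S.AB0L - (ρ.lam • ρ.R.comp S.B0L - S.B0L)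

theorem extR_Aext (y : X) : S.extR ρ (S.Aext ρ y) = ρ.lam • ρ.R y - y := by
  change S.extR ρ (ρ.lam • S.ι ρ y - (S.extR ρ).symm y) = _
  rw [map_sub, map_smul, extR_ι, LinearIsometryEquiv.apply_symm_apply]

theorem extR_B (v : U) : S.extR ρ (S.B ρ v) = S.RB ρ v := by
  change S.extR ρ (S.ι ρ (S.AB0L v) - S.Aext ρ (S.B0L v)) = _
  rw [map_sub, extR_ι, extR_Aext]
  rfl

theorem extR_Text (t : ℝ) (y : S.Extrapolation ρ) :
    S.extR ρ (S.Text ρ t y) = S.T t (S.extR ρ y) :=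
  (S.extR ρ).apply_symm_apply _

/-- No integrability is required because `extR` is an isomorphism. The reformulations in `X` are
therefore unconditional equivalences. -/
theorem extR_intervalIntegral (g : ℝ → S.Extrapolation ρ) (a b : ℝ) :
    S.extR ρ (∫ s in a..b, g s) = ∫ s in a..b, S.extR ρ (g s) := by
  have h : ∀ s : Set ℝ, S.extR ρ (∫ x in s, g x) = ∫ x in s, S.extR ρ (g x) := fun s =>
    (ContinuousLinearEquiv.integral_comp_comm
      (S.extR ρ : S.Extrapolation ρ ≃L[ℂ] X) g).symm
  rw [intervalIntegral, intervalIntegral, map_sub, h, h]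

theorem isLinearMildSolution_zero_iff {u : ℝ → U} {z : ℝ → X} :
    S.IsLinearMildSolution ρ 0 u z ↔ ∀ τ, IsTraj S.T ρ.R (S.RB ρ) τ u z := by
  have key : ∀ t, S.ι ρ (z t) = S.ι ρ (S.T t 0) + ∫ s in (0 : ℝ)..t,
      S.Text ρ (t - s) (S.B ρ (u s)) ↔
      ρ.R (z t) = ∫ s in (0 : ℝ)..t, S.T (t - s) (S.RB ρ (u s)) := fun t => by
    rw [← (S.extR ρ).injective.eq_iff, extR_ι, map_zero, map_zero, zero_add,
      extR_intervalIntegral]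
    simp only [extR_Text, extR_B]
  exact ⟨fun h τ t ht => (key t).1 (h t ht.1), fun h t ht => (key t).2 (h t t ⟨ht, le_rfl⟩)⟩

theorem isMildSolutionOn_iff {f : ℝ → X → X} {τ : ℝ} {x₀ : X} {u : ℝ → U} {x : ℝ → X} :
    S.IsMildSolutionOn ρ f τ x₀ u x ↔ ContinuousOn x (Icc 0 τ) ∧ ∀ t ∈ Icc 0 τ,
      ρ.R (x t) = ρ.R (S.T t x₀) +
        ∫ s in (0 : ℝ)..t, S.T (t - s) (ρ.R (f s (x s)) + S.RB ρ (u s)) := by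
  refine and_congr_right fun _ => forall₂_congr fun t _ => ?_
  rw [← (S.extR ρ).injective.eq_iff, map_add, extR_ι, extR_ι, extR_intervalIntegral]
  simp only [extR_Text, map_add, extR_B, extR_ι]

variable {K M ω : ℝ}

/-- Variation of constants formula in `X`. -/
theorem isMildSolutionOn_iff_of_isTraj (hK : ∀ t, 0 ≤ t → ‖S.T t‖ ≤ K) {f : ℝ → X → X} {L : ℝ}
    (hf : ∀ x, ContinuousOn (fun t => f t x) (Ici 0))
    (hL : ∀ t, 0 ≤ t → ∀ x y, ‖f t x - f t y‖ ≤ L * ‖x - y‖)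
    {τ : ℝ} {x₀ : X} {u : ℝ → U} {x z : ℝ → X} (hu : IntegrableOn u (Icc 0 τ))
    (hz : IsTraj S.T ρ.R (S.RB ρ) τ u z) :
    S.IsMildSolutionOn ρ f τ x₀ u x ↔ ContinuousOn x (Icc 0 τ) ∧ ∀ t ∈ Icc 0 τ,
      x t = S.T t x₀ + z t + ∫ s in (0 : ℝ)..t, S.T (t - s) (f s (x s)) := by
  rw [isMildSolutionOn_iff]
  refine and_congr_right fun hx => forall₂_congr fun t ht => ?_
  have hfi : IntegrableOn (fun s => f s (x s)) (Icc 0 t) :=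
    ((continuousOn_comp_of_lipschitz hf hL hx).mono
      (Icc_subset_Icc_right ht.2)).integrableOn_Icc
  have e1 : ∫ s in (0 : ℝ)..t, S.T (t - s) (ρ.R (f s (x s))) =
      ρ.R (∫ s in (0 : ℝ)..t, S.T (t - s) (f s (x s))) := by
    rw [← ContinuousLinearMap.intervalIntegral_comp_comm _
      (S.semigroup.intervalIntegrable_conv hK ht.1 le_rfl hfi)]
    refine intervalIntegral.integral_congr fun s hs => ?_
    rw [uIcc_of_le ht.1] at hs
    exact (S.R_comm ρ _ (by linarith [hs.2]) _).symm
  have e2 : ∫ s in (0 : ℝ)..t, S.T (t - s) (ρ.R (f s (x s)) + S.RB ρ (u s)) =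
      ρ.R (∫ s in (0 : ℝ)..t, S.T (t - s) (f s (x s))) + ρ.R (z t) := by
    rw [← e1, hz t ht]
    simp only [map_add]
    exact intervalIntegral.integral_add
      (S.semigroup.intervalIntegrable_conv hK ht.1 le_rfl (ρ.R.integrable_comp hfi))
      (IsTraj.intervalIntegrable S.semigroup hK hu ht le_rfl)
  -- Every term now lies in the range of `R`, which cancels by injectivity.
  rw [e2, ← map_add, ← map_add, (S.R_injective ρ).eq_iff, add_assoc,
    add_comm (z t)]

/-- Constant inputs have continuous trajectories. -/
theorem exists_isTraj_const (hK : ∀ t, 0 ≤ t → ‖S.T t‖ ≤ K) (c : U) :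
    ∃ z : ℝ → X, Continuous z ∧ ∀ τ, IsTraj S.T ρ.R (S.RB ρ) τ (fun _ => c) z := by
  have hcont : ∀ y, Continuous fun s : ℝ => S.T (max s 0) y := fun y =>
    (S.semigroup.continuous_max hK).comp (by fun_prop : Continuous fun s : ℝ => (s, y))
  -- As `B = 𝔄B₀ - A₋₁B₀`, the part with `A₋₁` integrates to `-∫ T₋₁(s) A₋₁ B₀c ds = B₀c - T(t)
  -- B₀c`, which lies in `X`.
  refine ⟨fun t => S.B0L c - S.T (max t 0) (S.B0L c) + ∫ s in (0 : ℝ)..t,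
    S.T (max s 0) (S.AB0L c), (continuous_const.sub (hcont _)).add
      (S.semigroup.continuous_integral hK _), fun τ t ht => ?_⟩
  obtain ⟨a, ha, ha'⟩ := ρ.right_inv (S.B0L c)
  have hi : ∀ y, IntervalIntegrable (fun s => S.T s y) volume 0 t := fun y => by
    refine ContinuousOn.intervalIntegrable ((S.semigroup.continuousOn y).mono ?_)
    rw [uIcc_of_le ht.1]
    exact fun s hs => hs.1
  have hmax : ∫ s in (0 : ℝ)..t, S.T (max s 0) (S.AB0L c) =
      ∫ s in (0 : ℝ)..t, S.T s (S.AB0L c) := by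
    refine intervalIntegral.integral_congr fun s hs => ?_
    rw [uIcc_of_le ht.1] at hs
    simp only [max_eq_left hs.1]
  have hR : ρ.R (∫ s in (0 : ℝ)..t, S.T s (S.AB0L c)) =
      ∫ s in (0 : ℝ)..t, S.T s (ρ.R (S.AB0L c)) := by
    rw [← ContinuousLinearMap.intervalIntegral_comp_comm _ (hi _)]
    refine intervalIntegral.integral_congr fun s hs => ?_
    rw [uIcc_of_le ht.1] at hs
    exact S.R_comm ρ s hs.1 _
  have hA := S.semigroup.sub_eq_integral hK
    ((S.generator (a : X) (S.A a)).1 (LinearPMap.mem_graph S.A a)) ht.1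
  have hAa : S.A a = ρ.lam • ρ.R (S.B0L c) - S.B0L c := by
    rw [← ha]
    exact (sub_eq_iff_eq_add.2 (sub_eq_iff_eq_add'.1 ha')).symm
  have hRB : ∀ s, S.T s (S.RB ρ c) = S.T s (ρ.R (S.AB0L c)) - S.T s (S.A a) := fun s => by
    rw [hAa, ← map_sub]
    rfl
  simp only
  rw [IsC0Semigroup.conv_const, max_eq_left ht.1, hmax, map_add, map_sub, hR, S.R_comm ρ t ht.1,
    ← ha]
  simp only [hRB]
  rw [intervalIntegral.integral_sub (hi _) (hi _), ← hA]
  abel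

/-- Input-to-state stability of the linear system implies admissibility. -/
theorem exists_isAdmissible_of_isISS {Z : InputClass}
    (hISS : IsISS Z (S.IsLinearMildSolution ρ)) :
    ∃ σ : ℝ, 0 ≤ σ ∧ IsAdmissible Z S.T ρ.R (S.RB ρ) σ := by
  obtain ⟨hex, β, γ, hβ, hγ, hb⟩ := hISS
  have hγ1 : 0 ≤ γ 1 := by
    rw [← hγ.1]
    exact (hγ.2.2 self_mem_Ici (mem_Ici.2 zero_le_one) zero_lt_one).le
  refine ⟨γ 1, hγ1, fun τ hτ u hu => ?_⟩
  obtain ⟨v, hv, hvu⟩ := hu.exists_extension hτ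
  obtain ⟨z, hz, -⟩ := hex 0 v hv
  have hzt := (S.isLinearMildSolution_zero_iff ρ).1 hz
  refine ⟨z, (hzt τ).congr hvu, fun t ht => ?_⟩
  rw [← InputClass.normOn_congr (Z := Z) (hvu.mono (Icc_subset_Icc_right ht.2))]
  rcases ht.1.eq_or_lt with rfl | ht0
  · rw [(hzt τ).map_zero (S.R_injective ρ) hτ.le, norm_zero]
    exact mul_nonneg hγ1 InputClass.normOn_nonneg
  have hβ0 : β ‖(0 : X)‖ t = 0 := by
    rw [norm_zero]
    exact (hβ.1 t ht.1).1
  rcases (InputClass.normOn_nonneg (Z := Z) (t := t) (u := v)).eq_or_lt with hN | hN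
  · have := hb 0 v z hv hz t ht0
    rw [hβ0, ← hN, hγ.1] at this
    rw [← hN]
    linarith
  -- The input is normalised for each `t` separately, so that `γ` is only evaluated at `1`.
  · set N := Z.normOn t v
    have h := hb 0 (fun s => (N : ℂ)⁻¹ • v s) (fun s => (N : ℂ)⁻¹ • z s)
      (fun r hr => (hv r hr).const_smul _)
      ((S.isLinearMildSolution_zero_iff ρ).2 fun τ => (hzt τ).const_smul _) t ht0
    have hNn : ‖(N : ℂ)⁻¹‖ = N⁻¹ := by
      rw [norm_inv, Complex.norm_real, Real.norm_of_nonneg hN.le]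
    rw [hβ0, zero_add, InputClass.normOn_const_smul, norm_smul, hNn, inv_mul_cancel₀ hN.ne',
      inv_mul_le_iff₀ hN] at h
    linarith

end BoundaryControlSystem

/-! ### Comparison functions and assembly of the theorem -/

theorem isClassKL_mul_exp {M α : ℝ} (hM : 0 < M) (hα : α < 0) :
    IsClassKL fun s t => M * s * Real.exp (α * t) := by
  refine ⟨fun t _ => ⟨by simp, Continuous.continuousOn (by fun_prop), fun s _ s' _ hs => ?_⟩,
    fun s hs => ⟨fun t _ => by positivity, Continuous.continuousOn (by fun_prop),
      fun t _ t' _ ht => ?_, ?_⟩⟩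
  · simp only
    gcongr
  · exact mul_lt_mul_of_pos_left (Real.exp_lt_exp.2 (mul_lt_mul_of_neg_left ht hα))
      (mul_pos hM hs)
  · have := (Real.tendsto_exp_atBot.comp (tendsto_id.const_mul_atTop_of_neg hα)).const_mul (M * s)
    rw [mul_zero] at this
    exact this

theorem isClassK_mul {σ : ℝ} (hσ : 0 < σ) : IsClassK fun r => σ * r :=
  ⟨mul_zero _, Continuous.continuousOn (by fun_prop), fun _ _ _ _ h =>
    mul_lt_mul_of_pos_left h hσ⟩

theorem mainTheorem2 {X U : Type*} [NormedAddCommGroup X] [NormedSpace ℂ X] [CompleteSpace X]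
    [NormedAddCommGroup U] [NormedSpace ℂ U] [CompleteSpace U]
    (S : BoundaryControlSystem X U) (ρ : S.ResolventPoint) (Z : InputClass)
    (hISS : IsISS Z (S.IsLinearMildSolution ρ))
    (M ω : ℝ) (hM : 1 ≤ M) (hω : ω < 0)
    (hT : ∀ t : ℝ, 0 < t → ‖S.T t‖ ≤ M * Real.exp (ω * t))
    (f : ℝ → X → X) (Lf : ℝ) (hLf : 0 < Lf)
    (hf_cont : ∀ x : X, ContinuousOn (fun t => f t x) (Ici 0))
    (hf_lip : ∀ t : ℝ, 0 ≤ t → ∀ x y : X, ‖f t x - f t y‖ ≤ Lf * ‖x - y‖)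
    (hf_zero : ∀ t : ℝ, 0 ≤ t → f t 0 = 0)
    (hsmall : ω + M * Lf < 0) :
    IsISS Z (S.IsGlobalMildSolution ρ f) ∧
    ∃ (β : ℝ → ℝ → ℝ) (σ : ℝ), IsClassKL β ∧ 0 < σ ∧
      ∀ (t : ℝ), 0 < t → ∀ (x₀ : X) (u : ℝ → U), Z.MemOn t u →
        (∃ x : ℝ → X, S.IsMildSolutionOn ρ f t x₀ u x) ∧
        ∀ x : ℝ → X, S.IsMildSolutionOn ρ f t x₀ u x →
          ‖x t‖ ≤ β ‖x₀‖ t + σ * Z.normOn t u ∧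
          ∀ K : ℝ, (∀ᵐ s ∂(volume.restrict (Icc 0 t)), ‖u s‖ ≤ K) →
            ‖x t‖ ≤ β ‖x₀‖ t + σ * K := by
  have hM0 : 0 < M := by linarith
  have hT' : ∀ t, 0 ≤ t → ‖S.T t‖ ≤ M * Real.exp (ω * t) := by
    intro t ht
    rcases ht.eq_or_lt with rfl | ht
    · rw [S.semigroup.map_zero, mul_zero, Real.exp_zero, mul_one]
      exact ContinuousLinearMap.norm_id_le.trans hM
    · exact hT t ht
  have hK : ∀ t, 0 ≤ t → ‖S.T t‖ ≤ M := fun t ht => IsC0Semigroup.norm_le_of_exp hT' hω ht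
  have hR := S.R_injective ρ
  have hRT : ∀ t, 0 ≤ t → ∀ y, ρ.R (S.T t y) = S.T t (ρ.R y) := fun t ht y => S.R_comm ρ t ht y
  obtain ⟨σ₀, hσ₀, hΦ⟩ := S.exists_isAdmissible_of_isISS ρ hISS
  obtain ⟨σ₁, hσ₁, hΦ₁⟩ := hΦ.exists_norm_le_of_ae_bound S.semigroup hω hT' hR hRT hσ₀
  have hunique : ∀ {τ : ℝ} {x₀ : X} {u : ℝ → U} {x y : ℝ → X}, 0 < τ → Z.MemOn τ u →
      S.IsMildSolutionOn ρ f τ x₀ u x → S.IsMildSolutionOn ρ f τ x₀ u y → EqOn x y (Icc 0 τ) := by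
    intro τ x₀ u x y hτ hu hx hy
    obtain ⟨z, hz, -⟩ := hΦ τ hτ u hu
    rw [S.isMildSolutionOn_iff_of_isTraj ρ hK hf_cont hf_lip hu.integrableOn hz] at hx hy
    exact eqOn_of_lipschitz S.semigroup hT' hf_cont hf_lip hLf.le hω hsmall hx.1 hy.1 hx.2 hy.2
  have hexists : ∀ {τ : ℝ} (x₀ : X) {u : ℝ → U}, 0 < τ → Z.MemOn τ u →
      ∃ x, S.IsMildSolutionOn ρ f τ x₀ u x := by
    intro τ x₀ u hτ hu
    obtain ⟨z, hz, -⟩ := hΦ τ hτ u hu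
    have hzc := hΦ.continuousOn S.semigroup hK hR hRT (S.exists_isTraj_const ρ hK) hσ₀ hτ hu hz
    obtain ⟨x, hx⟩ := exists_solution_of_lipschitz (h := fun t => S.T t x₀ + z t) S.semigroup hT'
      hf_cont hf_lip hLf.le hω hsmall hτ.le
      (((S.semigroup.continuousOn x₀).mono fun s hs => hs.1).add hzc)
    exact ⟨x, (S.isMildSolutionOn_iff_of_isTraj ρ hK hf_cont hf_lip hu.integrableOn hz).2 hx⟩
  set q : ℝ := ω / (ω + M * Lf) with hq
  have hq0 : 0 < q := div_pos_of_neg_of_neg hω hsmall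
  -- `q` is the amplification of constants in the comparison principle. The sum serves both gains at
  -- once, and the `1` keeps `σ` positive when both vanish.
  set σ : ℝ := q * (σ₀ + σ₁ + 1) with hσ
  have hσpos : 0 < σ := by positivity
  have hest : ∀ (t : ℝ), 0 < t → ∀ (x₀ : X) (u : ℝ → U), Z.MemOn t u →
      ∀ x : ℝ → X, S.IsMildSolutionOn ρ f t x₀ u x →
        ‖x t‖ ≤ M * ‖x₀‖ * Real.exp ((ω + M * Lf) * t) + σ * Z.normOn t u ∧
        ∀ K : ℝ, (∀ᵐ s ∂(volume.restrict (Icc 0 t)), ‖u s‖ ≤ K) →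
          ‖x t‖ ≤ M * ‖x₀‖ * Real.exp ((ω + M * Lf) * t) + σ * K := by
    intro t ht x₀ u hu x hx
    obtain ⟨z, hz, hzb⟩ := hΦ t ht u hu
    rw [S.isMildSolutionOn_iff_of_isTraj ρ hK hf_cont hf_lip hu.integrableOn hz] at hx
    have key : ∀ σ', σ' ≤ σ₀ + σ₁ + 1 → 0 ≤ σ' → ∀ B, 0 ≤ B → (∀ s ∈ Icc 0 t, ‖z s‖ ≤ σ' * B) →
        ‖x t‖ ≤ M * ‖x₀‖ * Real.exp ((ω + M * Lf) * t) + σ * B := by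
      intro σ' hσ' hσ'0 B hB hzB
      refine (norm_le_of_lipschitz hT' hf_lip hLf.le hf_zero hω hsmall (a := M * ‖x₀‖)
        (mul_nonneg hσ'0 hB) hx.1 hx.2 (fun s hs => ?_) t ⟨ht.le, le_rfl⟩).trans ?_
      · refine (norm_add_le _ _).trans (add_le_add ?_ (hzB s hs))
        exact ((S.T s).le_of_opNorm_le (hT' s hs.1) x₀).trans (le_of_eq (by ring))
      · rw [← hq, hσ, mul_assoc q]
        gcongr
    refine ⟨key σ₀ (by linarith) hσ₀ _ InputClass.normOn_nonneg fun s hs => (hzb s hs).trans ?_,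
      fun B hB => key σ₁ (by linarith) hσ₁ _ (InputClass.nonneg_of_ae_bound ht hB)
        (hΦ₁ t u z B ht hu hz hB)⟩
    exact mul_le_mul_of_nonneg_left (hu.normOn_mono hs.2) hσ₀
  refine ⟨⟨fun x₀ u hu => ?_, _, _, isClassKL_mul_exp hM0 hsmall, isClassK_mul hσpos,
    fun x₀ u x hu hx t ht => (hest t ht x₀ u (hu t ht) x (hx t ht)).1⟩,
    _, σ, isClassKL_mul_exp hM0 hsmall, hσpos, fun t ht x₀ u hu =>
      ⟨hexists x₀ ht hu, hest t ht x₀ u hu⟩⟩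
  have hmono : ∀ {τ τ' : ℝ} {x : ℝ → X}, τ ≤ τ' → S.IsMildSolutionOn ρ f τ' x₀ u x →
      S.IsMildSolutionOn ρ f τ x₀ u x := fun h hx =>
    ⟨hx.1.mono (Icc_subset_Icc_right h), fun t ht => hx.2 t ⟨ht.1, ht.2.trans h⟩⟩
  choose! x hx using fun τ (hτ : 0 < τ) => hexists x₀ hτ (hu τ hτ)
  -- The solutions on the intervals `[0,τ]` agree by uniqueness. Evaluating the one on `[0,t+1]` at
  -- `t` keeps the horizon positive also for `t = 0`.
  have hglobal : ∀ τ, 0 < τ → EqOn (fun t => x (t + 1) t) (x τ) (Icc 0 τ) := by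
    intro τ hτ t ht
    have ht1 : 0 < t + 1 := by linarith [ht.1]
    rcases le_total (t + 1) τ with h | h
    · exact hunique ht1 (hu _ ht1) (hx _ ht1) (hmono h (hx τ hτ)) ⟨ht.1, by linarith⟩
    · exact hunique hτ (hu τ hτ) (hmono h (hx _ ht1)) (hx τ hτ) ht
  have hsol : S.IsGlobalMildSolution ρ f x₀ u fun t => x (t + 1) t := by
    intro τ hτ
    refine ⟨(hx τ hτ).1.congr (hglobal τ hτ), fun t ht => ?_⟩
    rw [show (fun t => x (t + 1) t) t = x τ t from hglobal τ hτ ht, (hx τ hτ).2 t ht]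
    congr 1
    refine intervalIntegral.integral_congr fun s hs => ?_
    rw [uIcc_of_le ht.1] at hs
    simp only [show x (s + 1) s = x τ s from hglobal τ hτ ⟨hs.1, hs.2.trans ht.2⟩]
  refine ⟨_, hsol, fun y hy t ht => ?_⟩
  have ht1 : 0 < t + 1 := by linarith [mem_Ici.1 ht]
  exact hunique ht1 (hu _ ht1) (hy _ ht1) (hsol _ ht1) ⟨ht, by linarith⟩
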